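/- Let $Q:\mathbb R^4\to\mathbb R$ be a polynomial of degree two whose zero set $N=\{Q=0\}$ is a locally strictly convex hyperquadric: at every $x\in N$, $dQ_x\neq 0$, and the tangent hyperplane $T_xN=\ker dQ_x$ supports $N$ near $x$ with non-degenerate contact. Let $f:M\to\mathbb R^4$ be a smooth immersion of a surface $M$ with $f(M)\subset N$; write $T_pM=df_p(T_pM)\subset T_{f(p)}N\subset\mathbb R^4$. Write $D$ for the flat connection and $[\cdot,\cdot,\cdot,\cdot]$ for the determinant of $\mathbb R^4$. *Blaschke metric.* For a frame $u=(X_1,X_2,X_3)$ of $TN$ put $H_u(Y,Z)=[X_1,X_2,X_3,D_ZY]$; the Blaschke metric of $N$ is $\mathfrak G=H_u/(\det(H_u(X_i,X_j)))^{1/5}$ (real fifth root), which does not depend on $u$. Let $\zeta$ be an affine normal of $N$: a smooth transversal field with $D_X\zeta$ tangent to $N$ for all $X$ tangent to $N$, and such that $[X_1,X_2,X_3,\zeta]^2=|\det(h(X_i,X_j))|$ for all frames of $TN$, where $h(Y,Z)$ is the $\zeta$-component of $D_ZY$. The extended Blaschke metric is any extension of $\mathfrak G$ to a symmetric bilinear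 form on $\mathbb R^4$ at each point of $N$ for which $\zeta$ is orthogonal to $TN$ (the value $\mathfrak G(\zeta,\zeta)$ is arbitrary). Let $g$ be the restriction of $\mathfrak G$ to $M$. *Metric fields.* For a local tangent frame $(X_1,X_2)$ of $M$ and a smooth $\mathbb R^4$-valued field $\xi$ along $M$ put $G(Y,Z)=[X_1,X_2,D_ZY,\xi]$. If $G$ is positive definite, $\xi$ is a metric field, and $g_\xi=G/(\det(G(X_i,X_j)))^{1/4}$. *Equiaffine planes.* Let $\sigma$ be a smooth transversal plane bundle on an open $U\subset M$, i.e. $\mathbb R^4=T_pM\oplus\sigma_p$, and let $\nabla$ be the connection it induces: $\nabla_XY$ is the component of $D_XY$ in $T_pM$. The bundle $\sigma$ is equiaffine with respect to $g$ if $\nabla\omega_g=0$, where $\omega_g$ is the (local) area form of $g$. With $(\nabla g)(X,Y,Z)=(\nabla_Xg)(Y,Z)$, an equiaffine $\sigma$ is antisymmetric if, for local $g$-orthonormal tangent frames $(X_1,X_2)$, $$(\nabla g)(X_2,X_1,X_1)+(\nabla g)(X_1,X_2,X_1)=0,\qquad(\nabla g)(X_1,X_2,X_2)+(\nabla g)(X_2,X_1,X_2)=0,$$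 and symmetric if the same holds with both plus signs replaced by minus signs. A point $p\in M$ is an inflection if there is a non-zero linear functional $\lambda$ on $\mathbb R^4$, vanishing on $T_pM$, with $\lambda(D_XY)=0$ at $p$ for all tangent $X,Y$. **Corollary.** $N$ has an affine normal; near every point of $M$ there is a metric field $\xi$ with $g_\xi=g$; and for every affine normal $\zeta$ and every extended Blaschke metric the following hold. The planes $$\sigma_p=\{v\in\mathbb R^4:\ \mathfrak G_{f(p)}(v,w)=0\ \text{ for all } w\in T_pM\}$$ form a smooth transversal plane bundle on $M$ that is both an antisymmetric and a symmetric equiaffine plane bundle with respect to $g$. Conversely, if $\tau$ is an antisymmetric or a symmetric equiaffine plane bundle with respect to $g$ on an open set $U\subset M$, then $\tau_p=\sigma_p$ at every $p\in U$ that is not an inflection. Thus, at such points, the antisymmetric equiaffine plane and the symmetric equiaffine plane coincide and are the orthogonal plane of $T_pM$ with respect to the extended Blaschke metric. -/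

import Mathlib

open scoped Manifold ContDiff Topology

noncomputable section

namespace AffineSurface

/-- Affine 4-space, with its standard volume form `det4`. -/
abbrev R4 : Type := Fin 4 → ℝ

/-- The determinant `[a, b, c, d]` of four vectors. -/
def det4 (a b c d : R4) : ℝ := Matrix.det (Matrix.of ![a, b, c, d])

/-- The real fifth root (an odd function, unlike `fun x => x ^ (1 / 5)`). -/
def fifthRoot (x : ℝ) : ℝ := Real.sign x * |x| ^ (1 / 5 : ℝ)

/-! ### Hypersurfaces `N = {Q = 0}` of affine 4-space -/

/-- The tangent hyperplane of `{Q = 0}` at `x`. -/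
def hyperTangent (Q : R4 → ℝ) (x : R4) : Submodule ℝ R4 :=
  LinearMap.ker (fderiv ℝ Q x).toLinearMap

/-- `Y` is (an ambient smooth extension of) a vector field on the hypersurface `{Q = 0}`, defined
near `x` and tangent to the hypersurface. -/
def IsHyperTangentField (Q : R4 → ℝ) (x : R4) (Y : R4 → R4) : Prop :=
  ContDiffAt ℝ ∞ Y x ∧ ∀ᶠ y in 𝓝 x, Q y = 0 → Y y ∈ hyperTangent Q y

open Classical in
/-- A local tangent vector field of `{Q = 0}` with value `v` at `x`. -/
def hyperExtension (Q : R4 → ℝ) (x v : R4) : R4 → R4 :=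
  if h : ∃ Y, IsHyperTangentField Q x Y ∧ Y x = v then h.choose else 0

/-- `D_w Y` at `x`, for a local tangent field `Y` of `{Q = 0}` with `Y x = v`. Modulo the tangent
hyperplane it does not depend on `Y`. -/
def hyperD (Q : R4 → ℝ) (x v w : R4) : R4 :=
  fderiv ℝ (hyperExtension Q x v) x w

theorem exists_hyperTangentField {Q : R4 → ℝ} {x v : R4} (hQ : ContDiff ℝ ∞ Q)
    (h0 : fderiv ℝ Q x ≠ 0) (hv : v ∈ hyperTangent Q x) :
    ∃ Y, IsHyperTangentField Q x Y ∧ Y x = v := by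
  obtain ⟨n, hn⟩ : ∃ n, fderiv ℝ Q x n ≠ 0 := by
    by_contra! h
    exact h0 (ContinuousLinearMap.ext h)
  have hs : ∀ u : R4, ContDiff ℝ ∞ (fun y => fderiv ℝ Q y u) := fun u =>
    (hQ.fderiv_right (m := ∞) (by simp)).clm_apply contDiff_const
  have hv' : fderiv ℝ Q x v = 0 := hv
  refine ⟨fun y => v - (fderiv ℝ Q y v / fderiv ℝ Q y n) • n, ⟨?_, ?_⟩, by simp [hv']⟩
  · exact contDiffAt_const.sub
      ((((hs v).contDiffAt).div ((hs n).contDiffAt) hn).smul contDiffAt_const)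
  · filter_upwards [(hs n).continuous.continuousAt.eventually_ne hn] with y hy _
    change fderiv ℝ Q y (v - (fderiv ℝ Q y v / fderiv ℝ Q y n) • n) = 0
    simp [hy]

/-- A smooth function that vanishes on `{Q = 0}` near `x` has no derivative along it. -/
theorem fderiv_eq_zero_of_vanish {Q φ : R4 → ℝ} {x w : R4} (hQ : ContDiff ℝ ∞ Q)
    (hx : Q x = 0) (h0 : fderiv ℝ Q x ≠ 0) (hφ : ContDiffAt ℝ 1 φ x)
    (hz : ∀ᶠ y in 𝓝 x, Q y = 0 → φ y = 0) (hw : w ∈ hyperTangent Q x) :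
    fderiv ℝ φ x w = 0 := by
  have hw' : fderiv ℝ Q x w = 0 := hw
  have hext : IsLocalExtrOn φ {y | Q y = Q x} x := by
    left
    have h1 : φ x = 0 := hz.self_of_nhds hx
    refine (Filter.Eventually.filter_mono nhdsWithin_le_nhds hz).mp ?_
    filter_upwards [self_mem_nhdsWithin] with y hy h
    have hy' : Q y = Q x := hy
    rw [h (hy'.trans hx), h1]
  obtain ⟨a, b, hab, h⟩ := hext.exists_multipliers_of_hasStrictFDerivAt_1d
    (hQ.contDiffAt.hasStrictFDerivAt (by simp)) (hφ.hasStrictFDerivAt (by simp))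
  have hb : b ≠ 0 := by
    rintro rfl
    have ha : a ≠ 0 := fun ha => hab (by simp [ha])
    simp only [zero_smul, add_zero] at h
    exact (smul_ne_zero ha h0) h
  have h2 := congrArg (fun T : StrongDual ℝ R4 => T w) h
  simp [hw', hb] at h2
  exact h2

/-- Modulo the tangent hyperplane, `D_w Y` depends only on the value of `Y` at `x`. -/
theorem hyperD_sub_mem {Q : R4 → ℝ} {x w : R4} {Y : R4 → R4} (hQ : ContDiff ℝ ∞ Q)
    (hx : Q x = 0) (h0 : fderiv ℝ Q x ≠ 0) (hY : IsHyperTangentField Q x Y)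
    (hw : w ∈ hyperTangent Q x) :
    fderiv ℝ Y x w - hyperD Q x (Y x) w ∈ hyperTangent Q x := by
  have hex : ∃ Z, IsHyperTangentField Q x Z ∧ Z x = Y x := ⟨Y, hY, rfl⟩
  have hE : hyperExtension Q x (Y x) = hex.choose := dif_pos hex
  obtain ⟨hZ, hZx⟩ := hex.choose_spec
  rw [hyperD, hE]
  set Z := hex.choose
  have hd : ContDiff ℝ ∞ (fderiv ℝ Q) := hQ.fderiv_right (m := ∞) (by simp)
  have hYd : DifferentiableAt ℝ Y x := hY.1.differentiableAt (by simp)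
  have hZd : DifferentiableAt ℝ Z x := hZ.1.differentiableAt (by simp)
  have hdd : DifferentiableAt ℝ (fderiv ℝ Q) x := hd.contDiffAt.differentiableAt (by simp)
  have key := fderiv_eq_zero_of_vanish (φ := fun y => fderiv ℝ Q y (Y y - Z y)) hQ hx h0
    ((hd.contDiffAt.clm_apply (hY.1.sub hZ.1)).of_le (by simp)) (by
      filter_upwards [hY.2, hZ.2] with y h1 h2 hy
      have e1 : fderiv ℝ Q y (Y y) = 0 := h1 hy
      have e2 : fderiv ℝ Q y (Z y) = 0 := h2 hy
      simp [e1, e2]) hw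
  have hYZ : DifferentiableAt ℝ (fun y => Y y - Z y) x := hYd.sub hZd
  rw [fderiv_clm_apply hdd hYZ, fderiv_fun_sub hYd hZd] at key
  simpa [hyperTangent, hZx] using key

/-- `X` is a basis of the tangent hyperplane of `{Q = 0}` at `x`. -/
def IsHyperFrame (Q : R4 → ℝ) (x : R4) (X : Fin 3 → R4) : Prop :=
  LinearIndependent ℝ X ∧ ∀ i, X i ∈ hyperTangent Q x

/-- `H_X (v, w) = [X₁, X₂, X₃, D_w v]`. -/
def hyperForm (Q : R4 → ℝ) (x : R4) (X : Fin 3 → R4) (v w : R4) : ℝ :=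
  det4 (X 0) (X 1) (X 2) (hyperD Q x v w)

/-- `H_X (v, w) / (det H_X (X_i, X_j)) ^ (1 / 5)`. -/
def blaschkeOfFrame (Q : R4 → ℝ) (x : R4) (X : Fin 3 → R4) (v w : R4) : ℝ :=
  hyperForm Q x X v w /
    fifthRoot (Matrix.det (Matrix.of fun i j => hyperForm Q x X (X i) (X j)))

open Classical in
/-- The Blaschke metric of `{Q = 0}` at `x`, computed in any frame of the tangent hyperplane (it
does not depend on the frame, see `blaschke_eq`). -/
def blaschke (Q : R4 → ℝ) (x v w : R4) : ℝ :=
  if h : ∃ X, IsHyperFrame Q x X then blaschkeOfFrame Q x h.choose v w else 0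

theorem fifthRoot_pow_mul (d x : ℝ) : fifthRoot (d ^ 5 * x) = d * fifthRoot x := by
  have h1 : |d ^ 5 * x| ^ (1 / 5 : ℝ) = |d| * |x| ^ (1 / 5 : ℝ) := by
    rw [abs_mul, abs_pow, Real.mul_rpow (by positivity) (by positivity),
      ← Real.rpow_natCast, ← Real.rpow_mul (abs_nonneg d)]
    norm_num
  have h2 : Real.sign (d ^ 5 * x) = Real.sign d * Real.sign x := by
    rcases lt_trichotomy d 0 with hd | rfl | hd
    · have h5 : d ^ 5 < 0 := Odd.pow_neg (by decide) hd
      rw [Real.sign_of_neg hd]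
      rcases lt_trichotomy x 0 with hx | rfl | hx
      · rw [Real.sign_of_neg hx, Real.sign_of_pos (mul_pos_of_neg_of_neg h5 hx)]; norm_num
      · simp
      · rw [Real.sign_of_pos hx, Real.sign_of_neg (mul_neg_of_neg_of_pos h5 hx)]; norm_num
    · simp
    · have h5 : 0 < d ^ 5 := by positivity
      rw [Real.sign_of_pos hd]
      rcases lt_trichotomy x 0 with hx | rfl | hx
      · rw [Real.sign_of_neg hx, Real.sign_of_neg (mul_neg_of_pos_of_neg h5 hx)]; norm_num
      · simp
      · rw [Real.sign_of_pos hx, Real.sign_of_pos (mul_pos h5 hx)]; norm_num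
  have h3 : Real.sign d * |d| = d := by
    rcases lt_trichotomy d 0 with hd | rfl | hd
    · rw [Real.sign_of_neg hd, abs_of_neg hd]; ring
    · simp
    · rw [Real.sign_of_pos hd, abs_of_pos hd]; ring
  rw [fifthRoot, fifthRoot, h1, h2]
  calc Real.sign d * Real.sign x * (|d| * |x| ^ (1 / 5 : ℝ))
      = (Real.sign d * |d|) * (Real.sign x * |x| ^ (1 / 5 : ℝ)) := by ring
    _ = _ := by rw [h3]

theorem IsHyperFrame.exists_coords {Q : R4 → ℝ} {x v : R4} {X : Fin 3 → R4}
    (h0 : fderiv ℝ Q x ≠ 0) (hX : IsHyperFrame Q x X) (hv : v ∈ hyperTangent Q x) :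
    ∃ c : Fin 3 → ℝ, ∑ j, c j • X j = v := by
  have hr : LinearMap.range (fderiv ℝ Q x).toLinearMap = ⊤ := by
    apply LinearMap.range_eq_top.2
    apply LinearMap.surjective
    intro h
    exact h0 (ContinuousLinearMap.ext fun u => congrArg (fun T : R4 →ₗ[ℝ] ℝ => T u) h)
  have hk := LinearMap.finrank_range_add_finrank_ker (fderiv ℝ Q x).toLinearMap
  rw [hr, finrank_top] at hk
  have hs : Submodule.span ℝ (Set.range X) = hyperTangent Q x := by
    apply Submodule.eq_of_le_of_finrank_eq
    · rw [Submodule.span_le]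
      rintro _ ⟨i, rfl⟩
      exact hX.2 i
    · rw [finrank_span_eq_card hX.1, hyperTangent]
      simp at hk ⊢
      omega
  rw [← hs] at hv
  exact (Submodule.mem_span_range_iff_exists_fun ℝ).1 hv

theorem hyperD_sum_left {Q : R4 → ℝ} {x w : R4} (c : Fin 3 → ℝ)
    (Y : Fin 3 → R4) (hQ : ContDiff ℝ ∞ Q)
    (hx : Q x = 0) (h0 : fderiv ℝ Q x ≠ 0) (hY : ∀ i, Y i ∈ hyperTangent Q x)
    (hw : w ∈ hyperTangent Q x) :
    fderiv ℝ Q x (hyperD Q x (∑ j, c j • Y j) w) =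
      ∑ j, c j * fderiv ℝ Q x (hyperD Q x (Y j) w) := by
  have hZ := fun i => exists_hyperTangentField hQ h0 (hY i)
  choose Z hZ hZx using hZ
  have hd : ∀ i, DifferentiableAt ℝ (Z i) x := fun i => (hZ i).1.differentiableAt (by simp)
  have e1 : ∀ i, fderiv ℝ Q x (fderiv ℝ (Z i) x w) = fderiv ℝ Q x (hyperD Q x (Y i) w) := by
    intro i
    have h : fderiv ℝ Q x _ = 0 := hyperD_sub_mem hQ hx h0 (hZ i) hw
    rw [hZx, map_sub] at h
    linarith
  have hS : IsHyperTangentField Q x (fun y => ∑ j, c j • Z j y) := by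
    refine ⟨ContDiffAt.sum fun j _ => (hZ j).1.const_smul (c j), ?_⟩
    filter_upwards [Filter.eventually_all.2 fun i => (hZ i).2] with y hy hy0
    exact Submodule.sum_mem _ fun j _ => Submodule.smul_mem _ _ (hy j hy0)
  have h : fderiv ℝ Q x _ = 0 := hyperD_sub_mem hQ hx h0 hS hw
  have e2 : fderiv ℝ (fun y => ∑ j, c j • Z j y) x = ∑ j, c j • fderiv ℝ (Z j) x := by
    have h1 : HasFDerivAt (fun y => ∑ j, c j • Z j y) (∑ j, c j • fderiv ℝ (Z j) x) x :=
      HasFDerivAt.fun_sum fun j _ => (hd j).hasFDerivAt.const_smul (c j)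
    exact h1.fderiv
  simp only [hZx, e2, map_sub] at h
  rw [← sub_eq_zero.1 h]
  simp [map_sum, e1]

/-- The value of the Blaschke metric does not depend on the frame. -/
theorem blaschke_eq {Q : R4 → ℝ} {x : R4} {X : Fin 3 → R4} {v w : R4} (hQ : ContDiff ℝ ∞ Q)
    (hx : Q x = 0) (h0 : fderiv ℝ Q x ≠ 0) (hX : IsHyperFrame Q x X) :
    blaschke Q x v w = blaschkeOfFrame Q x X v w := by
  have hex : ∃ X, IsHyperFrame Q x X := ⟨X, hX⟩
  have hE : blaschke Q x v w = blaschkeOfFrame Q x hex.choose v w := dif_pos hex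
  have hY := hex.choose_spec
  rw [hE]
  set Y := hex.choose
  have hP := fun i => hX.exists_coords h0 (hY.2 i)
  choose P hP using hP
  have hdet : ∀ u, det4 (Y 0) (Y 1) (Y 2) u =
      Matrix.det (Matrix.of P) * det4 (X 0) (X 1) (X 2) u := by
    intro u
    have hm : (Matrix.of ![Y 0, Y 1, Y 2, u] : Matrix (Fin 4) (Fin 4) ℝ) =
        !![P 0 0, P 0 1, P 0 2, 0; P 1 0, P 1 1, P 1 2, 0; P 2 0, P 2 1, P 2 2, 0; 0, 0, 0, 1] *
          Matrix.of ![X 0, X 1, X 2, u] := by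
      ext i j
      fin_cases i <;>
        simp [Matrix.mul_apply, Fin.sum_univ_succ, ← hP]
    rw [det4, det4, hm, Matrix.det_mul]
    congr 1
    simp [Matrix.det_succ_row_zero, Fin.sum_univ_succ, Fin.succAbove]
    try ring
  have hform : ∀ a b, hyperForm Q x Y a b = Matrix.det (Matrix.of P) * hyperForm Q x X a b :=
    fun a b => hdet _
  obtain ⟨k, hk⟩ : ∃ k : ℝ, ∀ u, det4 (X 0) (X 1) (X 2) u = k * fderiv ℝ Q x u := by
    obtain ⟨n, hn⟩ : ∃ n, fderiv ℝ Q x n ≠ 0 := by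
      by_contra! h
      exact h0 (ContinuousLinearMap.ext h)
    refine ⟨det4 (X 0) (X 1) (X 2) n / fderiv ℝ Q x n, fun u => ?_⟩
    have hu : u - (fderiv ℝ Q x u / fderiv ℝ Q x n) • n ∈ hyperTangent Q x := by
      change fderiv ℝ Q x (u - (fderiv ℝ Q x u / fderiv ℝ Q x n) • n) = 0
      simp [hn]
    obtain ⟨c, hc⟩ := hX.exists_coords h0 hu
    have hu' : u = c 0 • X 0 + c 1 • X 1 + c 2 • X 2 +
        (fderiv ℝ Q x u / fderiv ℝ Q x n) • n := by
      rw [← sub_eq_iff_eq_add, ← hc]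
      simp [Fin.sum_univ_succ, add_assoc]
    have hl : ∀ r : ℝ, det4 (X 0) (X 1) (X 2) (c 0 • X 0 + c 1 • X 1 + c 2 • X 2 + r • n) =
        r * det4 (X 0) (X 1) (X 2) n := by
      intro r
      simp [det4, Matrix.det_succ_row_zero, Fin.sum_univ_succ, Fin.succAbove]
      ring
    rw [hu', hl, ← hu']
    field_simp
  have hb : ∀ a b, hyperForm Q x X a b = k * fderiv ℝ Q x (hyperD Q x a b) := fun a b => hk _
  have hgram : Matrix.det (Matrix.of fun i j => hyperForm Q x Y (Y i) (Y j)) =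
      Matrix.det (Matrix.of P) ^ 5 *
        Matrix.det (Matrix.of fun i j => hyperForm Q x X (X i) (X j)) := by
    have hm : (Matrix.of fun i j => hyperForm Q x Y (Y i) (Y j)) =
        Matrix.det (Matrix.of P) • (Matrix.of P *
          (Matrix.of fun i j => hyperForm Q x X (X i) (X j)) * (Matrix.of P).transpose) := by
      ext i j
      have hr : ∀ a, hyperD Q x a (Y j) = ∑ l, P j l • hyperD Q x a (X l) := by
        intro a
        rw [← hP j]
        simp [hyperD, map_sum]
      have hl : fderiv ℝ Q x (hyperD Q x (Y i) (Y j)) =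
          ∑ m, P i m * ∑ l, P j l * fderiv ℝ Q x (hyperD Q x (X m) (X l)) := by
        conv_lhs => rw [← hP i]
        rw [hyperD_sum_left (P i) X hQ hx h0 hX.2 (hY.2 j)]
        simp [hr, map_sum]
      simp only [Matrix.of_apply, Matrix.smul_apply, Matrix.mul_apply, Matrix.transpose_apply,
        smul_eq_mul, hform, hb, hl, Fin.sum_univ_three]
      ring
    rw [hm, Matrix.det_smul, Matrix.det_mul, Matrix.det_mul, Matrix.det_transpose]
    simp
    ring
  have hPne : Matrix.det (Matrix.of P) ≠ 0 := by
    have hm : ∀ c : Fin 3 → ℝ, Matrix.vecMul c (Matrix.of P) = 0 → c = 0 := by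
      intro c hc
      have hli := Fintype.linearIndependent_iff.1 hY.1 c (by
        have e : ∑ i, c i • Y i = ∑ j, (Matrix.vecMul c (Matrix.of P)) j • X j := by
          simp only [← hP, Fin.sum_univ_three, Matrix.vecMul, dotProduct, Matrix.of_apply]
          module
        rw [e, hc]
        simp)
      exact funext hli
    intro h
    obtain ⟨c, hc, hc0⟩ := Matrix.exists_vecMul_eq_zero_iff.2 h
    exact hc (hm c hc0)
  rw [blaschkeOfFrame, blaschkeOfFrame, hgram, fifthRoot_pow_mul, hform]
  exact mul_div_mul_left _ _ hPne

/-- The affine fundamental form of `{Q = 0}` relative to a transversal vector `z` at `x`: the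
coefficient of `z` in `D_w v`, for the decomposition of `R4` as tangent hyperplane plus `ℝ z`. -/
def affineForm (Q : R4 → ℝ) (x z v w : R4) : ℝ :=
  fderiv ℝ Q x (hyperD Q x v w) / fderiv ℝ Q x z

/-- `ζ` is an affine normal field of `{Q = 0}` (unique up to sign): it is smooth and transversal,
its derivatives in tangent directions are tangent, and the volume form `[·, ·, ·, ζ]` coincides up
to sign with the volume form of the affine fundamental form relative to `ζ`. -/
def IsAffineNormal (Q : R4 → ℝ) (ζ : R4 → R4) : Prop :=
  ∀ x, Q x = 0 →
    ContDiffAt ℝ ∞ ζ x ∧ ζ x ∉ hyperTangent Q x ∧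
    (∀ v ∈ hyperTangent Q x, fderiv ℝ ζ x v ∈ hyperTangent Q x) ∧
    ∀ X, IsHyperFrame Q x X →
      det4 (X 0) (X 1) (X 2) (ζ x) ^ 2 =
        |Matrix.det (Matrix.of fun i j => affineForm Q x (ζ x) (X i) (X j))|

/-- The component along `ζ x` of a vector at `x`. -/
def normalCoeff (Q : R4 → ℝ) (ζ : R4 → R4) (x v : R4) : ℝ :=
  fderiv ℝ Q x v / fderiv ℝ Q x (ζ x)

/-- The extended Blaschke metric on `R4` at `x`: it is the Blaschke metric on the tangent
hyperplane, `ζ x` is orthogonal to that hyperplane, and `ζ x` has square `κ x`. -/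
def extendedBlaschke (Q : R4 → ℝ) (ζ : R4 → R4) (κ : R4 → ℝ) (x v w : R4) : ℝ :=
  blaschke Q x (v - normalCoeff Q ζ x v • ζ x) (w - normalCoeff Q ζ x w • ζ x) +
    κ x * (normalCoeff Q ζ x v * normalCoeff Q ζ x w)

/-- `{Q = 0}` is a regular hypersurface near `x`, it is supported near `x` by its tangent
hyperplane, and the contact is non-degenerate: the Hessian at `x` of the restriction to `{Q = 0}`
of the height function `y ↦ dQ_x (y - x)` is non-degenerate. -/
def IsLocallyStrictlyConvexAt (Q : R4 → ℝ) (x : R4) : Prop :=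
  fderiv ℝ Q x ≠ 0 ∧
  ((∀ᶠ y in 𝓝 x, Q y = 0 → 0 ≤ fderiv ℝ Q x (y - x)) ∨
    (∀ᶠ y in 𝓝 x, Q y = 0 → fderiv ℝ Q x (y - x) ≤ 0)) ∧
  ∀ v ∈ hyperTangent Q x, v ≠ 0 →
    ∃ w ∈ hyperTangent Q x, fderiv ℝ Q x (hyperD Q x v w) ≠ 0

/-- `Q` is a polynomial function of degree two on `R4`. -/
def IsQuadratic (Q : R4 → ℝ) : Prop :=
  ∃ (B : LinearMap.BilinForm ℝ R4) (l : R4 →ₗ[ℝ] ℝ) (c : ℝ),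
    B.IsSymm ∧ B ≠ 0 ∧ ∀ x, Q x = B x x + l x + c

/-- `{Q = 0}` is a locally strictly convex hyperquadric. -/
def IsConvexHyperquadric (Q : R4 → ℝ) : Prop :=
  IsQuadratic Q ∧ ∀ x, Q x = 0 → IsLocallyStrictlyConvexAt Q x

/-! ### Immersed surfaces in affine 4-space -/

section Surface

variable {M : Type*} [TopologicalSpace M] [ChartedSpace (EuclideanSpace ℝ (Fin 2)) M]

/-- The derivative at `p` of a map into `R4`. -/
def dmap (f : M → R4) (p : M) : TangentSpace (𝓡 2) p →L[ℝ] R4 :=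
  mfderiv (𝓡 2) 𝓘(ℝ, R4) f p

/-- The derivative at `p` of a real function. -/
def dfun (φ : M → ℝ) (p : M) : TangentSpace (𝓡 2) p →L[ℝ] ℝ :=
  mfderiv (𝓡 2) 𝓘(ℝ, ℝ) φ p

/-- `f` is a smooth immersion. -/
def IsSmoothImmersion (f : M → R4) : Prop :=
  ContMDiff (𝓡 2) 𝓘(ℝ, R4) ∞ f ∧ ∀ p, Function.Injective (dmap f p)

/-- The tangent plane at `p`, as a subspace of `R4`. -/
def tangentPlane (f : M → R4) (p : M) : Submodule ℝ R4 :=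
  LinearMap.range (dmap f p).toLinearMap

/-- `Y` is a smooth tangent vector field on the open set `V` (for an immersion `f`, the field is
smooth if and only if it is smooth as an `R4`-valued map). -/
def IsTangentField (f : M → R4) (V : Set M) (Y : (q : M) → TangentSpace (𝓡 2) q) : Prop :=
  ContMDiffOn (𝓡 2) 𝓘(ℝ, R4) ∞ (fun q => dmap f q (Y q)) V

/-- `D_x Y` at `p`, for a tangent vector `x` at `p` and a tangent field `Y`. -/
def flatD (f : M → R4) (p : M) (x : TangentSpace (𝓡 2) p)
    (Y : (q : M) → TangentSpace (𝓡 2) q) : R4 :=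
  dmap (fun q => dmap f q (Y q)) p x

/-- `σ` is a smooth transversal plane bundle on `U`. -/
def IsTransversalBundle (f : M → R4) (U : Set M) (σ : M → Submodule ℝ R4) : Prop :=
  ∀ p ∈ U, IsCompl (tangentPlane f p) (σ p) ∧
    ∃ (V : Set M) (ξ₁ ξ₂ : M → R4), IsOpen V ∧ p ∈ V ∧ V ⊆ U ∧
      ContMDiffOn (𝓡 2) 𝓘(ℝ, R4) ∞ ξ₁ V ∧ ContMDiffOn (𝓡 2) 𝓘(ℝ, R4) ∞ ξ₂ V ∧
      ∀ q ∈ V, σ q = Submodule.span ℝ {ξ₁ q, ξ₂ q}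

open Classical in
/-- The connection induced by `σ`: the tangent vector `∇_x Y` at `p` such that
`D_x Y - ∇_x Y` lies in `σ p` (it exists and is unique if `σ p` is transversal). -/
def nabla (f : M → R4) (σ : M → Submodule ℝ R4) (p : M) (x : TangentSpace (𝓡 2) p)
    (Y : (q : M) → TangentSpace (𝓡 2) q) : TangentSpace (𝓡 2) p :=
  if h : ∃ t : TangentSpace (𝓡 2) p, flatD f p x Y - dmap f p t ∈ σ p then h.choose else 0

/-- `(∇β)(x, Y, Z) = x (β (Y, Z)) - β (∇_x Y, Z) - β (Y, ∇_x Z)` at `p`. -/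
def nablaForm (f : M → R4) (σ : M → Submodule ℝ R4)
    (β : (q : M) → TangentSpace (𝓡 2) q → TangentSpace (𝓡 2) q → ℝ) (p : M)
    (x : TangentSpace (𝓡 2) p) (Y Z : (q : M) → TangentSpace (𝓡 2) q) : ℝ :=
  dfun (fun q => β q (Y q) (Z q)) p x - β p (nabla f σ p x Y) (Z p) - β p (Y p) (nabla f σ p x Z)

/-- `α` is a smooth area form on `V` of the metric `g` (for one of the local orientations). -/
def IsAreaForm (f : M → R4) (g : (q : M) → TangentSpace (𝓡 2) q → TangentSpace (𝓡 2) q → ℝ)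
    (V : Set M) (α : (q : M) → TangentSpace (𝓡 2) q [⋀^Fin 2]→ₗ[ℝ] ℝ) : Prop :=
  (∀ q ∈ V, ∀ u v : TangentSpace (𝓡 2) q,
    |α q ![u, v]| = Real.sqrt |g q u u * g q v v - g q u v ^ 2|) ∧
  ∀ Y Z, IsTangentField f V Y → IsTangentField f V Z →
    ContMDiffOn (𝓡 2) 𝓘(ℝ, ℝ) ∞ (fun q => α q ![Y q, Z q]) V

/-- `σ` is equiaffine on `U` with respect to the metric `g`: `∇ α = 0` for the area forms `α` of `g`. -/
def IsEquiaffine (f : M → R4) (g : (q : M) → TangentSpace (𝓡 2) q → TangentSpace (𝓡 2) q → ℝ)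
    (U : Set M) (σ : M → Submodule ℝ R4) : Prop :=
  ∀ V, IsOpen V → V ⊆ U → ∀ α, IsAreaForm f g V α →
    ∀ Y Z, IsTangentField f V Y → IsTangentField f V Z → ∀ p ∈ V, ∀ x : TangentSpace (𝓡 2) p,
      nablaForm f σ (fun q u v => α q ![u, v]) p x Y Z = 0

/-- `X₁, X₂` is a smooth tangent frame on `V`, orthonormal with respect to `g`. -/
def IsOrthonormalFrame (f : M → R4)
    (g : (q : M) → TangentSpace (𝓡 2) q → TangentSpace (𝓡 2) q → ℝ)
    (V : Set M) (X₁ X₂ : (q : M) → TangentSpace (𝓡 2) q) : Prop :=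
  IsTangentField f V X₁ ∧ IsTangentField f V X₂ ∧ ∀ q ∈ V,
    g q (X₁ q) (X₁ q) = 1 ∧ g q (X₁ q) (X₂ q) = 0 ∧ g q (X₂ q) (X₁ q) = 0 ∧
      g q (X₂ q) (X₂ q) = 1

/-- `σ` is an antisymmetric equiaffine plane bundle on `U` with respect to `g`. -/
def IsAntisymmetricEquiaffine (f : M → R4)
    (g : (q : M) → TangentSpace (𝓡 2) q → TangentSpace (𝓡 2) q → ℝ)
    (U : Set M) (σ : M → Submodule ℝ R4) : Prop :=
  IsTransversalBundle f U σ ∧ IsEquiaffine f g U σ ∧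
  ∀ V, IsOpen V → V ⊆ U → ∀ X₁ X₂, IsOrthonormalFrame f g V X₁ X₂ → ∀ p ∈ V,
    nablaForm f σ g p (X₂ p) X₁ X₁ + nablaForm f σ g p (X₁ p) X₂ X₁ = 0 ∧
    nablaForm f σ g p (X₁ p) X₂ X₂ + nablaForm f σ g p (X₂ p) X₁ X₂ = 0

/-- `σ` is a symmetric equiaffine plane bundle on `U` with respect to `g`. -/
def IsSymmetricEquiaffine (f : M → R4)
    (g : (q : M) → TangentSpace (𝓡 2) q → TangentSpace (𝓡 2) q → ℝ)
    (U : Set M) (σ : M → Submodule ℝ R4) : Prop :=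
  IsTransversalBundle f U σ ∧ IsEquiaffine f g U σ ∧
  ∀ V, IsOpen V → V ⊆ U → ∀ X₁ X₂, IsOrthonormalFrame f g V X₁ X₂ → ∀ p ∈ V,
    nablaForm f σ g p (X₂ p) X₁ X₁ - nablaForm f σ g p (X₁ p) X₂ X₁ = 0 ∧
    nablaForm f σ g p (X₁ p) X₂ X₂ - nablaForm f σ g p (X₂ p) X₁ X₂ = 0

/-- `p` is an inflection: the second fundamental form along some non-zero conormal vanishes at
`p`. Conormals at `p` are the linear functionals that vanish on the tangent plane, which is the
dual of any transversal plane. -/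
def IsInflection (f : M → R4) (p : M) : Prop :=
  ∃ lam : R4 →ₗ[ℝ] ℝ, lam ≠ 0 ∧ (∀ v ∈ tangentPlane f p, lam v = 0) ∧
    ∀ V, IsOpen V → p ∈ V → ∀ Y, IsTangentField f V Y → ∀ x : TangentSpace (𝓡 2) p,
      lam (flatD f p x Y) = 0

/-- `G_X (Y, z) = [X₁, X₂, D_z Y, ξ]` at `p`. -/
def surfaceForm (f : M → R4) (X₁ X₂ : (q : M) → TangentSpace (𝓡 2) q) (ξ : M → R4) (p : M)
    (Y : (q : M) → TangentSpace (𝓡 2) q) (z : TangentSpace (𝓡 2) p) : ℝ :=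
  det4 (dmap f p (X₁ p)) (dmap f p (X₂ p)) (flatD f p z Y) (ξ p)

/-- `ξ` is a metric field on `U`, relative to the tangent frame `X₁, X₂`: the form `G_X` is
positive definite on `U`. -/
def IsMetricField (f : M → R4) (U : Set M) (X₁ X₂ : (q : M) → TangentSpace (𝓡 2) q)
    (ξ : M → R4) : Prop :=
  IsTangentField f U X₁ ∧ IsTangentField f U X₂ ∧
  (∀ q ∈ U, LinearIndependent ℝ ![X₁ q, X₂ q]) ∧
  ContMDiffOn (𝓡 2) 𝓘(ℝ, R4) ∞ ξ U ∧
  ∀ V, IsOpen V → V ⊆ U → ∀ Y, IsTangentField f V Y → ∀ q ∈ V, Y q ≠ 0 →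
    0 < surfaceForm f X₁ X₂ ξ q Y (Y q)

/-- The metric `g_ξ (Y, z) = G_X (Y, z) / (det G_X (X_i, X_j)) ^ (1 / 4)` at `p`. -/
def transversalMetric (f : M → R4) (X₁ X₂ : (q : M) → TangentSpace (𝓡 2) q) (ξ : M → R4) (p : M)
    (Y : (q : M) → TangentSpace (𝓡 2) q) (z : TangentSpace (𝓡 2) p) : ℝ :=
  surfaceForm f X₁ X₂ ξ p Y z /
    (surfaceForm f X₁ X₂ ξ p X₁ (X₁ p) * surfaceForm f X₁ X₂ ξ p X₂ (X₂ p) -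
      surfaceForm f X₁ X₂ ξ p X₁ (X₂ p) * surfaceForm f X₁ X₂ ξ p X₂ (X₁ p)) ^ (1 / 4 : ℝ)

/-- The restriction to the surface `f` of the Blaschke metric of `{Q = 0}`. -/
def blaschkeOn (Q : R4 → ℝ) (f : M → R4) (q : M) (u v : TangentSpace (𝓡 2) q) : ℝ :=
  blaschke Q (f q) (dmap f q u) (dmap f q v)

end Surface

end AffineSurface

end

open scoped Manifold ContDiff Topology

noncomputable section

namespace AffineSurface

/-! ### Quadrics -/

/-! The whole statement rests on one fact: on a locally strictly convex hyperquadric the Blaschke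
metric is the restriction of a bilinear form `G` on affine 4-space that does not depend on the point
(`IsConvexHyperquadric.exists_flat_form`). Let `B` be the quadratic part of `Q`. Differentiating
`dQ(Y) = 0` along a tangent direction `w` gives `dQ(D_w Y) = -2 B(Y, w)`, so the Blaschke metric is
pointwise a multiple of `B`. The multiple is constant because there is a field `Z = z + ε x`,
pointing to the centre or along the axis, for which `dQ(Z)` is constant and `det B(X_i, X_j)` is a
constant times `[X₁, X₂, X₃, Z]²`. The volume condition on an affine normal `ζ` forces `|dQ(ζ)|` to
be constant. Differentiating and using that `D_w ζ` is tangent gives `B(ζ, w) = 0`. Hence every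
extended Blaschke metric agrees with `G` as soon as one argument is tangent to the surface, and `σ`
is the `G`-orthogonal plane.

Since `G` is constant, it is parallel for `D`, and orthogonal projection of `D` to the surface is a
metric connection: `∇g = 0`. All the conditions on `σ` follow at once. The metric field is a
rescaled field tangent to `N` and transversal to `M`: then `[X₁, X₂, ·, ξ]` is a multiple of `dQ`,
and `dQ(D_z Y)` is a multiple of `g(Y, z)`.

For the converse, let `C = ∇^τ - ∇^σ`. It is symmetric because the torsions agree, and `C_x` is
trace-free because both planes are equiaffine. The antisymmetry or symmetry condition leaves two
free components. In an orthonormal frame, `D₁X₁ - D₂X₂` and `D₁X₂` lie in the kernel of `dQ`, which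
is only one dimension larger than the tangent plane. So some nonzero combination of them is tangent,
and its tangential part is the same for both planes. This yields two linear equations of determinant
`4a² + b² ≠ 0`, hence `C = 0` (`IsQuadricSurface.eq_orthoPlane`). Then the transversal parts of all
`D_X Y` lie in `σ ∩ τ`. Away from inflections these, together with the tangent plane, span the
space, which forces `τ = σ` (`eq_of_not_isInflection`). -/

/-- `Q` is `x ↦ B (x, x) + l x + c` for a constant `c`, with `B` symmetric. -/
structure IsQuadricWith (Q : R4 → ℝ) (B : R4 →L[ℝ] R4 →L[ℝ] ℝ) (l : R4 →L[ℝ] ℝ) : Prop where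
  symm : ∀ u v, B u v = B v u
  eq : ∃ c, ∀ x, Q x = B x x + l x + c

namespace IsQuadricWith

variable {Q : R4 → ℝ} {B : R4 →L[ℝ] R4 →L[ℝ] ℝ} {l : R4 →L[ℝ] ℝ}

theorem contDiff (h : IsQuadricWith Q B l) : ContDiff ℝ ∞ Q := by
  obtain ⟨c, hc⟩ := h.eq
  rw [funext hc]
  exact ((B.contDiff.clm_apply contDiff_id).add l.contDiff).add contDiff_const

theorem fderiv_apply (h : IsQuadricWith Q B l) (x v : R4) :
    fderiv ℝ Q x v = 2 * B x v + l v := by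
  obtain ⟨c, hc⟩ := h.eq
  have h1 : HasFDerivAt (fun x => B x x + l x + c) _ x :=
    ((B.hasFDerivAt (x := x).clm_apply (hasFDerivAt_id x)).add l.hasFDerivAt).add_const c
  rw [funext hc, h1.fderiv]
  simp [h.symm v x]
  ring

theorem expand (h : IsQuadricWith Q B l) (x v : R4) :
    Q (x + v) = Q x + fderiv ℝ Q x v + B v v := by
  obtain ⟨c, hc⟩ := h.eq
  rw [h.fderiv_apply, hc, hc]
  simp [h.symm v x]
  ring

theorem mem_hyperTangent {x v : R4} : v ∈ hyperTangent Q x ↔ fderiv ℝ Q x v = 0 := Iff.rfl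

theorem fderiv_eq (h : IsQuadricWith Q B l) (x : R4) : fderiv ℝ Q x = (2 : ℝ) • B x + l := by
  ext v
  simp [h.fderiv_apply]

/-- The derivative of `y ↦ dQ_y (Y y)`. -/
theorem fderiv_fderiv_apply (h : IsQuadricWith Q B l) {x : R4} {Y : R4 → R4}
    (hY : DifferentiableAt ℝ Y x) (w : R4) :
    fderiv ℝ (fun y => fderiv ℝ Q y (Y y)) x w = 2 * B w (Y x) + fderiv ℝ Q x (fderiv ℝ Y x w) := by
  have h1 : HasFDerivAt (fun y => (2 : ℝ) • B y + l) ((2 : ℝ) • B) x :=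
    (B.hasFDerivAt.const_smul (2 : ℝ)).add_const l
  simp_rw [h.fderiv_eq]
  rw [(h1.clm_apply hY.hasFDerivAt).fderiv]
  simp
  ring

/-- Differentiating `dQ(Y) = 0` along the quadric gives `2 B(w, Y) + dQ(D_w Y) = 0`. This identifies
the second fundamental form along `dQ` with the quadratic part of `Q`. -/
theorem fderiv_hyperD (h : IsQuadricWith Q B l) {x v w : R4} (hx : Q x = 0)
    (h0 : fderiv ℝ Q x ≠ 0) (hv : v ∈ hyperTangent Q x) (hw : w ∈ hyperTangent Q x) :
    fderiv ℝ Q x (hyperD Q x v w) = -2 * B v w := by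
  obtain ⟨Y, hY, rfl⟩ := exists_hyperTangentField h.contDiff h0 hv
  have h1 : fderiv ℝ Q x _ = 0 := hyperD_sub_mem h.contDiff hx h0 hY hw
  have hYd : DifferentiableAt ℝ Y x := hY.1.differentiableAt (by simp)
  have h2 := fderiv_eq_zero_of_vanish (φ := fun y => fderiv ℝ Q y (Y y)) h.contDiff hx h0
    (((h.contDiff.fderiv_right (m := ∞) (by simp)).contDiffAt.clm_apply hY.1).of_le (by simp))
    (hY.2.mono fun y hy hy0 => hy hy0) hw
  rw [h.fderiv_fderiv_apply hYd, h.symm] at h2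
  rw [map_sub] at h1
  linarith

/-- Points of the quadric close to `x`, near a tangent vector `v` up to second order. -/
theorem exists_near (h : IsQuadricWith Q B l) {x v n : R4} (hx : Q x = 0)
    (hv : v ∈ hyperTangent Q x) (hn : fderiv ℝ Q x n = 1) {ε : ℝ} (hε : 0 < ε) {P : R4 → Prop}
    (hP : ∀ᶠ y in 𝓝 x, P y) :
    ∃ t r : ℝ, 0 < t ∧ |r + B v v| ≤ ε ∧ Q (x + (t • v + (t ^ 2 * r) • n)) = 0 ∧
      P (x + (t • v + (t ^ 2 * r) • n)) := by
  set r₀ := -B v v with hr₀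
  -- The exact Taylor expansion gives `Q = t² F(t, r)` along this family. At `t = 0`, `F` is `r +
  -- B(v, v)`, which changes sign across `[r₀ - ε, r₀ + ε]`; this persists for small `t`, and the
  -- intermediate value theorem supplies `r`.
  let F : ℝ → ℝ → ℝ := fun t r => r + B v v + 2 * t * r * B v n + t ^ 2 * r ^ 2 * B n n
  have hv' : fderiv ℝ Q x v = 0 := hv
  have hF : ∀ t r, Q (x + (t • v + (t ^ 2 * r) • n)) = t ^ 2 * F t r := by
    intro t r
    rw [h.expand, hx]
    simp [hv', hn, h.symm n v, F]
    ring
  have hc : ∀ r, Filter.Tendsto (fun t => F t r) (𝓝 0) (𝓝 (F 0 r)) := by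
    intro r
    have : Continuous fun t => F t r := by fun_prop
    exact this.tendsto 0
  have h1 : ∀ᶠ t in 𝓝 0, F t (r₀ - ε) < 0 :=
    (hc _).eventually_lt_const (by simp only [F, hr₀]; linarith)
  have h2 : ∀ᶠ t in 𝓝 0, 0 < F t (r₀ + ε) :=
    (hc _).eventually_const_lt (by simp only [F, hr₀]; linarith)
  -- `r` is only found after `t` has been fixed, so `P` is needed uniformly in `r`; compactness of
  -- the interval provides this.
  have h3 : ∀ᶠ t in 𝓝 (0 : ℝ), ∀ r ∈ Set.Icc (r₀ - ε) (r₀ + ε),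
      P (x + (t • v + (t ^ 2 * r) • n)) := by
    have hG : ∀ r ∈ Set.Icc (r₀ - ε) (r₀ + ε), ∀ᶠ z : ℝ × ℝ in 𝓝 (0, r),
        P (x + (z.1 • v + (z.1 ^ 2 * z.2) • n)) := by
      intro r _
      have hG' : Continuous fun z : ℝ × ℝ => x + (z.1 • v + (z.1 ^ 2 * z.2) • n) := by fun_prop
      have := hG'.tendsto (0, r)
      simp only [zero_smul, ne_eq, OfNat.ofNat_ne_zero, not_false_eq_true, zero_pow, zero_mul,
        add_zero] at this
      exact this.eventually hP
    exact isCompact_Icc.eventually_forall_of_forall_eventually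
      (P := fun (t r : ℝ) => P (x + (t • v + (t ^ 2 * r) • n))) hG
  have h4 : ∃ᶠ t in 𝓝 (0 : ℝ), 0 < t :=
    (Filter.Eventually.frequently (f := 𝓝[>] (0 : ℝ)) self_mem_nhdsWithin).filter_mono
      nhdsWithin_le_nhds
  obtain ⟨t, ht, ht1, ht2, ht3⟩ := (h4.and_eventually (h1.and (h2.and h3))).exists
  have hcont : ContinuousOn (F t) (Set.Icc (r₀ - ε) (r₀ + ε)) := by
    have : Continuous (F t) := by fun_prop
    exact this.continuousOn
  obtain ⟨r, hr, hr0⟩ := intermediate_value_Icc (by linarith) hcont ⟨ht1.le, ht2.le⟩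
  refine ⟨t, r, ht, ?_, by rw [hF, hr0, mul_zero], ht3 r hr⟩
  rw [abs_le]
  constructor <;> linarith [hr.1, hr.2]

theorem exists_fderiv_eq_one {x : R4} (h0 : fderiv ℝ Q x ≠ 0) : ∃ n, fderiv ℝ Q x n = 1 := by
  obtain ⟨n, hn⟩ : ∃ n, fderiv ℝ Q x n ≠ 0 := by
    by_contra! h
    exact h0 (ContinuousLinearMap.ext h)
  exact ⟨(fderiv ℝ Q x n)⁻¹ • n, by simp [hn]⟩

/-- If `{Q = 0}` lies on one side of its tangent hyperplane, then `B` is semidefinite on it. -/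
theorem nonpos_of_support (h : IsQuadricWith Q B l) {x v : R4} (hx : Q x = 0)
    (h0 : fderiv ℝ Q x ≠ 0) (hv : v ∈ hyperTangent Q x) (s : ℝ)
    (hs : ∀ᶠ y in 𝓝 x, Q y = 0 → 0 ≤ s * fderiv ℝ Q x (y - x)) : s * B v v ≤ 0 := by
  by_contra! hpos
  obtain ⟨n, hn⟩ := exists_fderiv_eq_one h0
  have hb : B v v ≠ 0 := by
    rintro hb
    simp [hb] at hpos
  -- The height of the nearby point is `t² r`. With this tolerance `r` stays within half of `|B(v,
  -- v)|` of `-B(v, v)`, so `s r` would be negative.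
  obtain ⟨t, r, ht, hr, hq, hp⟩ := h.exists_near hx hv hn (ε := |B v v| / 2)
    (by positivity) hs
  have hv' : fderiv ℝ Q x v = 0 := hv
  have h1 := hp hq
  simp only [add_sub_cancel_left, map_add, map_smul, hv', hn, smul_eq_mul, mul_zero, zero_add,
    mul_one] at h1
  have h2 : 0 ≤ s * r := by
    by_contra! hneg
    have : s * (t ^ 2 * r) < 0 := by
      have := mul_neg_of_pos_of_neg (pow_pos ht 2) hneg
      linarith
    linarith
  have h3 : |s * r + s * B v v| ≤ s * B v v / 2 := by
    rw [← mul_add, abs_mul]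
    calc |s| * |r + B v v| ≤ |s| * (|B v v| / 2) := by gcongr
      _ = |s * B v v| / 2 := by rw [abs_mul]; ring
      _ = _ := by rw [abs_of_pos hpos]
  have := (abs_le.1 h3).2
  linarith

/-- `B` is definite on the tangent hyperplanes of a locally strictly convex quadric. -/
theorem exists_definite (h : IsQuadricWith Q B l) {x : R4} (hx : Q x = 0)
    (hc : IsLocallyStrictlyConvexAt Q x) :
    ∃ s : ℝ, ∀ v ∈ hyperTangent Q x, v ≠ 0 → 0 < s * B v v := by
  obtain ⟨h0, hsup, hnd⟩ := hc
  obtain ⟨s, hs0, hs⟩ : ∃ s : ℝ, s ≠ 0 ∧ ∀ u ∈ hyperTangent Q x, 0 ≤ s * B u u := by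
    rcases hsup with hs | hs
    · refine ⟨-1, by norm_num, fun u hu => ?_⟩
      have := h.nonpos_of_support hx h0 hu 1 (hs.mono fun y hy h => by linarith [hy h])
      linarith
    · refine ⟨1, by norm_num, fun u hu => ?_⟩
      have := h.nonpos_of_support hx h0 hu (-1) (hs.mono fun y hy h => by linarith [hy h])
      linarith
  refine ⟨s, fun v hv hv0 => (hs v hv).lt_of_ne fun hz => ?_⟩
  obtain ⟨w, hw, hvw⟩ := hnd v hv hv0
  rw [h.fderiv_hyperD hx h0 hv hw] at hvw
  have hz' : B v v = 0 := by simpa [hs0] using hz.symm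
  have hvw' : s * B v w ≠ 0 := mul_ne_zero hs0 (by simpa using hvw)
  -- A semidefinite form cannot have an isotropic `v` with `B(v, w) ≠ 0`: along the line `w - c v`
  -- it is affine in `c`, and this `c` makes its value `-1`.
  have key := hs (w - ((s * B w w + 1) / (2 * (s * B v w))) • v)
    (Submodule.sub_mem _ hw (Submodule.smul_mem _ _ hv))
  have e : s * B (w - ((s * B w w + 1) / (2 * (s * B v w))) • v)
      (w - ((s * B w w + 1) / (2 * (s * B v w))) • v) = -1 := by
    simp only [map_sub, map_smul, sub_apply, smul_apply, smul_eq_mul, hz', h.symm w v]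
    have h3 : B v w ≠ 0 := right_ne_zero_of_mul hvw'
    field_simp
    ring
  rw [e] at key
  linarith

end IsQuadricWith

theorem IsConvexHyperquadric.exists_isQuadricWith {Q : R4 → ℝ} (hQ : IsConvexHyperquadric Q) :
    ∃ B l, IsQuadricWith Q B l := by
  obtain ⟨⟨B, l, c, hB, -, h⟩, -⟩ := hQ
  exact ⟨LinearMap.toContinuousBilinearMap B, LinearMap.toContinuousLinearMap l,
    fun u v => hB.eq u v, c, h⟩

/-! ### Volumes and Gram determinants on the tangent hyperplanes of a quadric -/

/-- Change of basis: the Gram matrix is `P E Pᵀ` with `P` the matrix of rows `a, b, c, d` and `E`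
the matrix of `B` in the standard basis, so `k = det E`. -/
theorem det_gram_eq (B : R4 →L[ℝ] R4 →L[ℝ] ℝ) : ∃ k : ℝ, ∀ a b c d : R4,
    Matrix.det (Matrix.of fun i j : Fin 4 => B (![a, b, c, d] i) (![a, b, c, d] j)) =
      k * det4 a b c d ^ 2 := by
  refine ⟨Matrix.det (Matrix.of fun i j : Fin 4 => B (Pi.single i 1) (Pi.single j 1)),
    fun a b c d => ?_⟩
  have key : (Matrix.of fun i j : Fin 4 => B (![a, b, c, d] i) (![a, b, c, d] j)) =
      Matrix.of ![a, b, c, d] *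
        (Matrix.of fun i j : Fin 4 => B (Pi.single i 1) (Pi.single j 1)) *
          (Matrix.of ![a, b, c, d]).transpose := by
    have h : ∀ u v : R4, B u v = ∑ j, (∑ i, u i * B (Pi.single i 1) (Pi.single j 1)) * v j := by
      intro u v
      conv_lhs => rw [← Finset.univ_sum_single u, ← Finset.univ_sum_single v]
      have hs : ∀ (w : R4) i, (Pi.single i (w i) : R4) = w i • Pi.single i 1 := fun w i => by
        rw [← Pi.single_smul, smul_eq_mul, mul_one]
      simp only [hs, map_sum, map_smul, sum_apply, smul_apply, smul_eq_mul]
      refine Finset.sum_congr rfl fun j _ => ?_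
      rw [Finset.sum_mul, Finset.mul_sum]
      exact Finset.sum_congr rfl fun i _ => by ring
    ext i j
    simp only [Matrix.of_apply, Matrix.mul_apply, Matrix.transpose_apply]
    exact h _ _
  rw [key, Matrix.det_mul, Matrix.det_mul, Matrix.det_transpose, det4]
  ring

/-- Both `[X₁, X₂, X₃, ·]` and `dQ_x` vanish on the tangent hyperplane, so they are proportional;
cross-multiplying avoids naming the factor. -/
theorem IsHyperFrame.det4_mul {Q : R4 → ℝ} {x : R4} {X : Fin 3 → R4} (h0 : fderiv ℝ Q x ≠ 0)
    (hX : IsHyperFrame Q x X) (n u : R4) :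
    det4 (X 0) (X 1) (X 2) u * fderiv ℝ Q x n = det4 (X 0) (X 1) (X 2) n * fderiv ℝ Q x u := by
  have hu : fderiv ℝ Q x n • u - fderiv ℝ Q x u • n ∈ hyperTangent Q x := by
    change fderiv ℝ Q x (fderiv ℝ Q x n • u - fderiv ℝ Q x u • n) = 0
    simp [mul_comm]
  obtain ⟨c, hc⟩ := hX.exists_coords h0 hu
  have h1 : det4 (X 0) (X 1) (X 2) (fderiv ℝ Q x n • u - fderiv ℝ Q x u • n) = 0 := by
    rw [← hc, Fin.sum_univ_three]
    simp [det4, Matrix.det_succ_row_zero, Fin.sum_univ_succ, Fin.succAbove]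
    ring
  have h2 : det4 (X 0) (X 1) (X 2) (fderiv ℝ Q x n • u - fderiv ℝ Q x u • n) =
      det4 (X 0) (X 1) (X 2) u * fderiv ℝ Q x n - det4 (X 0) (X 1) (X 2) n * fderiv ℝ Q x u := by
    simp [det4, Matrix.det_succ_row_zero, Fin.sum_univ_succ, Fin.succAbove]
    ring
  linarith

theorem exists_isHyperFrame {Q : R4 → ℝ} {x : R4} (h0 : fderiv ℝ Q x ≠ 0) :
    ∃ X, IsHyperFrame Q x X := by
  have hr : LinearMap.range (fderiv ℝ Q x).toLinearMap = ⊤ := by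
    apply LinearMap.range_eq_top.2
    apply LinearMap.surjective
    intro h
    exact h0 (ContinuousLinearMap.ext fun u => congrArg (fun T : R4 →ₗ[ℝ] ℝ => T u) h)
  have hk := LinearMap.finrank_range_add_finrank_ker (fderiv ℝ Q x).toLinearMap
  rw [hr, finrank_top] at hk
  have h3 : Module.finrank ℝ (hyperTangent Q x) = 3 := by
    rw [hyperTangent]
    simp at hk ⊢
    omega
  let b := Module.finBasisOfFinrankEq ℝ _ h3
  have hli := b.linearIndependent.map' (hyperTangent Q x).subtype (Submodule.ker_subtype _)
  exact ⟨(hyperTangent Q x).subtype ∘ b, hli, fun i => (b i).2⟩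

namespace IsQuadricWith

variable {Q : R4 → ℝ} {B : R4 →L[ℝ] R4 →L[ℝ] ℝ} {l : R4 →L[ℝ] ℝ}

/-- The transversal field pointing to the centre (or along the axis) of a quadric. -/
theorem exists_axis (h : IsQuadricWith Q B l) (hc : ∀ x, Q x = 0 → IsLocallyStrictlyConvexAt Q x)
    (hne : ∃ x, Q x = 0) :
    ∃ (z : R4) (ε ν K : ℝ), ν ≠ 0 ∧ ∀ x, Q x = 0 → fderiv ℝ Q x (z + ε • x) = ν ∧
      ∀ X, IsHyperFrame Q x X → Matrix.det (Matrix.of fun i j => B (X i) (X j)) =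
        K * det4 (X 0) (X 1) (X 2) (z + ε • x) ^ 2 := by
  -- Nondegenerate `B`: the quadric has the centre `-z`, where `B z = l / 2`. Degenerate `B`: the
  -- axis is a kernel vector `n`.
  by_cases hB : ∀ n, B n = 0 → n = 0
  · let B' : R4 →ₗ[ℝ] Module.Dual ℝ R4 :=
      { toFun := fun u => (B u).toLinearMap
        map_add' := fun u v => by ext; simp
        map_smul' := fun r u => by ext; simp }
    have hinj : Function.Injective B' := by
      rw [injective_iff_map_eq_zero]
      intro n hn
      exact hB n (ContinuousLinearMap.ext fun u => congrArg (fun T : R4 →ₗ[ℝ] ℝ => T u) hn)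
    obtain ⟨z, hz⟩ := (LinearMap.injective_iff_surjective_of_finrank_eq_finrank
      (f := B') Subspace.dual_finrank_eq.symm).1 hinj ((1 / 2 : ℝ) • l.toLinearMap)
    have hz' : ∀ v, B z v = 1 / 2 * l v := fun v =>
      congrArg (fun T : R4 →ₗ[ℝ] ℝ => T v) hz
    have hd : ∀ x v, fderiv ℝ Q x v = 2 * B (z + (1 : ℝ) • x) v := fun x v => by
      rw [h.fderiv_apply]
      simp [hz']
      ring
    have hQz : Q (-z) ≠ 0 := fun h0 => (hc _ h0).1 (by
      ext v
      rw [hd]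
      simp)
    -- Expanding at the centre gives `0 = Q x = Q(-z) + B(Z, Z)` for `Z = z + x`, while `dQ_x(Z) = 2
    -- B(Z, Z)`.
    have hν : ∀ x, Q x = 0 → fderiv ℝ Q x (z + (1 : ℝ) • x) = -2 * Q (-z) := by
      intro x hx
      have e := h.expand (-z) (z + (1 : ℝ) • x)
      have e2 : fderiv ℝ Q (-z) = 0 := by
        ext v
        rw [hd]
        simp
      rw [e2] at e
      simp only [one_smul, neg_add_cancel_left, zero_apply, hx] at e
      rw [hd, one_smul]
      linarith
    obtain ⟨k, hk⟩ := det_gram_eq B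
    refine ⟨z, 1, -2 * Q (-z), k / (-Q (-z)), by simpa using hQz, fun x hx => ⟨hν x hx, ?_⟩⟩
    intro X hX
    have hBX : ∀ i, B (z + (1 : ℝ) • x) (X i) = 0 := fun i => by
      have : fderiv ℝ Q x (X i) = 0 := hX.2 i
      rw [hd] at this
      linarith
    have hBX' : ∀ i, B (X i) (z + (1 : ℝ) • x) = 0 := fun i => by rw [h.symm, hBX]
    have hBB : B (z + (1 : ℝ) • x) (z + (1 : ℝ) • x) = - Q (-z) := by
      have := hν x hx
      rw [hd] at this
      linarith
    -- `Z` is `B`-orthogonal to the frame, so the `4 × 4` Gram determinant is the `3 × 3` one times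
    -- `B(Z, Z) = -Q(-z)`.
    have key := hk (X 0) (X 1) (X 2) (z + (1 : ℝ) • x)
    generalize z + (1 : ℝ) • x = Z at *
    rw [div_mul_eq_mul_div, ← key, eq_div_iff (neg_ne_zero.2 hQz), ← hBB]
    simp [Matrix.det_succ_row_zero, Fin.sum_univ_succ, Fin.succAbove, hBX, hBX']
    ring
  · push Not at hB
    obtain ⟨n, hn, hn0⟩ := hB
    have hd : ∀ x, fderiv ℝ Q x n = l n := fun x => by
      rw [h.fderiv_apply, h.symm, hn]
      simp
    -- Otherwise `n` would be tangent and isotropic, against definiteness on a tangent hyperplane;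
    -- this is where a point of the quadric is needed.
    have hln : l n ≠ 0 := by
      intro hln
      obtain ⟨x, hx⟩ := hne
      obtain ⟨s, hs⟩ := h.exists_definite hx (hc x hx)
      have := hs n (by rw [mem_hyperTangent, hd, hln]) hn0
      simp [hn] at this
    -- Gram determinants of `B` itself vanish on four vectors including `n`. After adding `l ⊗ l`,
    -- row reduction by the row of `n` leaves `det B(X_i, X_j) * l(n)²`.
    obtain ⟨k, hk⟩ := det_gram_eq (B + l.smulRight l)
    refine ⟨n, 0, l n, k / l n ^ 2, hln, fun x hx => ⟨by simp [hd], ?_⟩⟩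
    intro X hX
    have key := hk (X 0) (X 1) (X 2) n
    have hn' : ∀ u, B u n = 0 := fun u => by rw [h.symm, hn, zero_apply]
    rw [zero_smul, add_zero, div_mul_eq_mul_div, ← key, eq_div_iff (pow_ne_zero 2 hln)]
    simp [Matrix.det_succ_row_zero, Fin.sum_univ_succ, Fin.succAbove, hn, hn']
    ring

/-- The Gram matrix of `s B` is positive definite, and its determinant is `s³ det B(X_i, X_j)`;
division by `s²` keeps the sign because the dimension is odd. -/
theorem mul_det_pos (h : IsQuadricWith Q B l) {x : R4} {X : Fin 3 → R4}
    (hX : IsHyperFrame Q x X) {s : ℝ} (hs : ∀ v ∈ hyperTangent Q x, v ≠ 0 → 0 < s * B v v) :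
    0 < s * Matrix.det (Matrix.of fun i j => B (X i) (X j)) := by
  have hp : Matrix.PosDef (s • Matrix.of fun i j : Fin 3 => B (X i) (X j)) := by
    refine Matrix.PosDef.of_dotProduct_mulVec_pos ?_ fun c hc => ?_
    · exact Matrix.IsHermitian.ext fun i j => by simp [h.symm (X i) (X j)]
    · have h1 := hs (∑ i, c i • X i)
        (Submodule.sum_mem _ fun i _ => Submodule.smul_mem _ _ (hX.2 i))
        (fun h0 => hc (funext (Fintype.linearIndependent_iff.1 hX.1 c h0)))
      have e : dotProduct (star c) ((s • Matrix.of fun i j : Fin 3 => B (X i) (X j)).mulVec c) =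
          s * B (∑ i, c i • X i) (∑ i, c i • X i) := by
        simp [dotProduct, Matrix.mulVec, Fin.sum_univ_three]
        ring
      rw [e]
      exact h1
  have := hp.det_pos
  rw [Matrix.det_smul, Fintype.card_fin] at this
  have hs2 : s ≠ 0 := by
    rintro rfl
    simp at this
  have : 0 < s ^ 2 * (s * Matrix.det (Matrix.of fun i j => B (X i) (X j))) := by linarith
  exact (mul_pos_iff_of_pos_left (by positivity)).1 this

end IsQuadricWith

theorem mul_fifthRoot_pos {x : ℝ} (hx : x ≠ 0) : 0 < x * fifthRoot x := by
  have h1 : 0 < |x| ^ (1 / 5 : ℝ) := Real.rpow_pos_of_pos (abs_pos.2 hx) _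
  rcases hx.lt_or_gt with h | h
  · rw [fifthRoot, Real.sign_of_neg h]
    nlinarith
  · rw [fifthRoot, Real.sign_of_pos h]
    nlinarith

/-- Affine normals are orthogonal to the tangent hyperplanes for the quadratic part of `Q`. -/
theorem IsAffineNormal.apply_eq_zero {Q : R4 → ℝ} {B : R4 →L[ℝ] R4 →L[ℝ] ℝ} {l : R4 →L[ℝ] ℝ}
    (h : IsQuadricWith Q B l) {z : R4} {ε ν K : ℝ} (hν : ν ≠ 0)
    (h0 : ∀ x, Q x = 0 → fderiv ℝ Q x ≠ 0)
    (hd : ∀ x, Q x = 0 → ∀ X, IsHyperFrame Q x X →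
      Matrix.det (Matrix.of fun i j => B (X i) (X j)) ≠ 0)
    (hz : ∀ x, Q x = 0 → fderiv ℝ Q x (z + ε • x) = ν ∧
      ∀ X, IsHyperFrame Q x X → Matrix.det (Matrix.of fun i j => B (X i) (X j)) =
        K * det4 (X 0) (X 1) (X 2) (z + ε • x) ^ 2)
    {ζ : R4 → R4} (hζ : IsAffineNormal Q ζ) {x w : R4} (hx : Q x = 0)
    (hw : w ∈ hyperTangent Q x) : B (ζ x) w = 0 := by
  -- The affine form of `ζ` is `(-2 / s) B` with `s = dQ(ζ)`, and `[X, ζ] = D s / ν` with `D = [X,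
  -- Z]`. The volume condition reads `D² s² / ν² = (2 / |s|)³ |K| D²`, and `D` cancels.
  have hpow : ∀ y, Q y = 0 → |fderiv ℝ Q y (ζ y)| ^ 5 = 8 * (|K| * ν ^ 2) := by
    intro y hy
    obtain ⟨X, hX⟩ := exists_isHyperFrame (h0 y hy)
    obtain ⟨-, ht, -, hvol⟩ := hζ y hy
    have ht' : fderiv ℝ Q y (ζ y) ≠ 0 := ht
    have h1 := hvol X hX
    obtain ⟨hzν, hzK⟩ := hz y hy
    have h2 := hzK X hX
    have h3 := hX.det4_mul (h0 y hy) (z + ε • y) (ζ y)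
    rw [hzν] at h3
    have hd0 := hd y hy X hX
    have h4 : (Matrix.of fun i j => affineForm Q y (ζ y) (X i) (X j)) =
        (-2 / fderiv ℝ Q y (ζ y)) • Matrix.of fun i j => B (X i) (X j) := by
      ext i j
      simp only [Matrix.of_apply, Matrix.smul_apply, smul_eq_mul, affineForm,
        h.fderiv_hyperD hy (h0 y hy) (hX.2 i) (hX.2 j)]
      ring
    rw [h4, Matrix.det_smul, Fintype.card_fin, h2] at h1
    rw [h2] at hd0
    generalize det4 (X 0) (X 1) (X 2) (z + ε • y) = D at *
    generalize det4 (X 0) (X 1) (X 2) (ζ y) = D' at *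
    generalize fderiv ℝ Q y (ζ y) = s at *
    have hD : D ≠ 0 := by
      rintro rfl
      simp at hd0
    have e1 : D' = D * s / ν := by
      rw [eq_div_iff hν, h3]
    have hs : 0 < |s| := abs_pos.2 ht'
    rw [e1, abs_mul, abs_mul, abs_pow, abs_div, abs_of_nonneg (sq_nonneg D)] at h1
    have e2 : (D * s / ν) ^ 2 = D ^ 2 * |s| ^ 2 / ν ^ 2 := by
      rw [sq_abs]
      field_simp
    rw [e2, abs_neg, abs_two] at h1
    field_simp at h1
    linarith
  obtain ⟨hs, ht, hζt, -⟩ := hζ x hx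
  have ht' : fderiv ℝ Q x (ζ x) ≠ 0 := ht
  have hQ' : ContDiffAt ℝ ∞ (fun y => fderiv ℝ Q y (ζ y)) x :=
    (h.contDiff.fderiv_right (m := ∞) (by simp)).contDiffAt.clm_apply hs
  -- The tenth power removes the absolute value, so that the constant quantity is a smooth function.
  have h2 := fderiv_eq_zero_of_vanish
    (φ := fun y => (fderiv ℝ Q y (ζ y)) ^ 10 - (8 * (|K| * ν ^ 2)) ^ 2) h.contDiff hx (h0 x hx)
    (((hQ'.pow 10).sub contDiffAt_const).of_le (by simp)) (Filter.Eventually.of_forall fun y hy => by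
      rw [← hpow y hy, ← pow_mul, Even.pow_abs (by decide), sub_self]) hw
  have hQd : DifferentiableAt ℝ (fun y => fderiv ℝ Q y (ζ y)) x := hQ'.differentiableAt (by simp)
  rw [fderiv_sub_const, fderiv_fun_pow _ hQd] at h2
  have h3 : fderiv ℝ (fun y => fderiv ℝ Q y (ζ y)) x w = 0 := by
    simpa [ht'] using h2
  -- The derivative of `dQ(ζ)` is `2 B(w, ζ) + dQ(D_w ζ)`, whose last term vanishes because `D_w ζ`
  -- is tangent.
  rw [h.fderiv_fderiv_apply (hs.differentiableAt (by simp))] at h3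
  have h4 : fderiv ℝ Q x (fderiv ℝ ζ x w) = 0 := hζt w hw
  rw [h4, h.symm] at h3
  linarith

/-- Any constant multiple of `z + ε x` has tangent derivatives, since its derivative is a multiple
of the identity. Only the scale `c` remains, and the volume condition fixes it by `c⁵ |ν|³ = 8 |K|`.
-/
theorem exists_isAffineNormal_of_axis {Q : R4 → ℝ} {B : R4 →L[ℝ] R4 →L[ℝ] ℝ} {l : R4 →L[ℝ] ℝ}
    (h : IsQuadricWith Q B l) {z : R4} {ε ν K : ℝ} (hν : ν ≠ 0) (hK : K ≠ 0)
    (h0 : ∀ x, Q x = 0 → fderiv ℝ Q x ≠ 0)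
    (hz : ∀ x, Q x = 0 → fderiv ℝ Q x (z + ε • x) = ν ∧
      ∀ X, IsHyperFrame Q x X → Matrix.det (Matrix.of fun i j => B (X i) (X j)) =
        K * det4 (X 0) (X 1) (X 2) (z + ε • x) ^ 2) :
    ∃ ζ, IsAffineNormal Q ζ := by
  obtain ⟨c, hc0, hc⟩ : ∃ c : ℝ, 0 < c ∧ c ^ 5 = 8 * |K| / |ν| ^ 3 := by
    have hp : 0 < 8 * |K| / |ν| ^ 3 := by positivity
    refine ⟨(8 * |K| / |ν| ^ 3) ^ (1 / 5 : ℝ), Real.rpow_pos_of_pos hp _, ?_⟩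
    rw [← Real.rpow_natCast, ← Real.rpow_mul hp.le]
    norm_num
  refine ⟨fun y => c • (z + ε • y), fun x hx => ?_⟩
  have hν' : fderiv ℝ Q x (c • (z + ε • x)) = c * ν := by
    rw [map_smul, (hz x hx).1, smul_eq_mul]
  refine ⟨?_, ?_, ?_, ?_⟩
  · fun_prop
  · rw [IsQuadricWith.mem_hyperTangent, hν']
    exact mul_ne_zero hc0.ne' hν
  · intro v hv
    have h1 : HasFDerivAt (fun y : R4 => c • (z + ε • y)) (c • ε • ContinuousLinearMap.id ℝ R4) x :=
      (((hasFDerivAt_id x).const_smul ε).const_add z).const_smul c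
    rw [h1.fderiv]
    exact Submodule.smul_mem _ _ (Submodule.smul_mem _ _ hv)
  · intro X hX
    have h4 : (Matrix.of fun i j => affineForm Q x (c • (z + ε • x)) (X i) (X j)) =
        (-2 / (c * ν)) • Matrix.of fun i j => B (X i) (X j) := by
      ext i j
      simp only [Matrix.of_apply, Matrix.smul_apply, smul_eq_mul, affineForm, hν',
        h.fderiv_hyperD hx (h0 x hx) (hX.2 i) (hX.2 j)]
      ring
    have h5 : det4 (X 0) (X 1) (X 2) (c • (z + ε • x)) =
        c * det4 (X 0) (X 1) (X 2) (z + ε • x) := by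
      generalize z + ε • x = Z
      simp [det4, Matrix.det_succ_row_zero, Fin.sum_univ_succ, Fin.succAbove]
      ring
    rw [h4, Matrix.det_smul, Fintype.card_fin, (hz x hx).2 X hX, h5]
    generalize det4 (X 0) (X 1) (X 2) (z + ε • x) = D
    rw [abs_mul, abs_mul, abs_pow, abs_div, abs_of_nonneg (sq_nonneg D), abs_mul, abs_of_pos hc0]
    have hν2 : |ν| ≠ 0 := abs_ne_zero.2 hν
    have e : 8 * |K| = c ^ 5 * |ν| ^ 3 := by
      rw [hc]
      field_simp
    norm_num
    field_simp
    linear_combination (-D ^ 2) * e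

/-- On a locally strictly convex hyperquadric the Blaschke metric is the restriction of a constant
bilinear form, proportional to the quadratic part of `Q`; the affine normals are orthogonal to the
tangent hyperplanes for this form. -/
theorem IsConvexHyperquadric.exists_flat_form {Q : R4 → ℝ} (hQ : IsConvexHyperquadric Q)
    (hne : ∃ x, Q x = 0) :
    (∃ ζ, IsAffineNormal Q ζ) ∧
    ∃ (G : R4 →L[ℝ] R4 →L[ℝ] ℝ) (ρ : ℝ), (∀ u v, G u v = G v u) ∧ ρ ≠ 0 ∧
      (∃ l : R4 →L[ℝ] ℝ, ∀ x v, fderiv ℝ Q x v = ρ * G x v + l v) ∧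
      (∀ x, Q x = 0 → ∀ v ∈ hyperTangent Q x, ∀ w ∈ hyperTangent Q x,
        blaschke Q x v w = G v w) ∧
      (∀ x, Q x = 0 → ∀ v ∈ hyperTangent Q x, v ≠ 0 → 0 < G v v) ∧
      ∀ ζ, IsAffineNormal Q ζ → ∀ x, Q x = 0 → ∀ w ∈ hyperTangent Q x, G (ζ x) w = 0 := by
  obtain ⟨B, l, h⟩ := hQ.exists_isQuadricWith
  have h0 : ∀ x, Q x = 0 → fderiv ℝ Q x ≠ 0 := fun x hx => (hQ.2 x hx).1
  obtain ⟨z, ε, ν, K, hν, hz⟩ := h.exists_axis hQ.2 hne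
  have hd : ∀ x, Q x = 0 → ∀ X, IsHyperFrame Q x X →
      Matrix.det (Matrix.of fun i j => B (X i) (X j)) ≠ 0 := by
    intro x hx X hX
    obtain ⟨s, hs⟩ := h.exists_definite hx (hQ.2 x hx)
    exact right_ne_zero_of_mul (h.mul_det_pos hX hs).ne'
  have hK : K ≠ 0 := by
    obtain ⟨x, hx⟩ := hne
    obtain ⟨X, hX⟩ := exists_isHyperFrame (h0 x hx)
    have := hd x hx X hX
    rw [(hz x hx).2 X hX] at this
    exact left_ne_zero_of_mul this
  refine ⟨exists_isAffineNormal_of_axis h hν hK h0 hz, ?_⟩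
  have hr := mul_fifthRoot_pos (x := -8 * K / ν ^ 3) (by simp [hK, hν])
  set r := fifthRoot (-8 * K / ν ^ 3) with hrdef
  have hr0 : r ≠ 0 := right_ne_zero_of_mul hr.ne'
  -- `r` has the sign of `-K / ν³`. This is what makes the Blaschke metric positive definite rather
  -- than negative definite.
  have hKr : ν * r * K < 0 := by
    have h1 : 0 < ν ^ 4 := by positivity
    have h2 := mul_pos h1 hr
    have h3 : ν ^ 4 * (-8 * K / ν ^ 3 * r) = -8 * (ν * r * K) := by field_simp
    linarith
  -- With `D = [X, Z]`, the form `H` is `(D / ν)(-2 B)` and its Gram determinant is `D⁵ (-8 K /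
  -- ν³)`, with fifth root `D r`. The frame cancels in the quotient; `ρ` is then forced by `2 B = ρ
  -- G`.
  refine ⟨(-2 / (ν * r)) • B, -(ν * r), ?_, ?_, ?_, ?_, ?_, ?_⟩
  · intro u v
    simp [h.symm u v]
  · simp [hν, hr0]
  · refine ⟨l, fun x v => ?_⟩
    rw [h.fderiv_apply]
    simp only [smul_apply, smul_eq_mul]
    field_simp
  · intro x hx v hv w hw
    obtain ⟨X, hX⟩ := exists_isHyperFrame (h0 x hx)
    obtain ⟨hzν, hzK⟩ := hz x hx
    have h2 := hzK X hX
    have hd0 := hd x hx X hX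
    rw [h2] at hd0
    have hform : ∀ a ∈ hyperTangent Q x, ∀ b ∈ hyperTangent Q x, hyperForm Q x X a b =
        det4 (X 0) (X 1) (X 2) (z + ε • x) / ν * (-2 * B a b) := by
      intro a ha b hb
      have h3 := hX.det4_mul (h0 x hx) (z + ε • x) (hyperD Q x a b)
      rw [h.fderiv_hyperD hx (h0 x hx) ha hb, hzν] at h3
      rw [hyperForm, div_mul_eq_mul_div, ← h3]
      field_simp
    have hm : (Matrix.of fun i j => hyperForm Q x X (X i) (X j)) =
        (det4 (X 0) (X 1) (X 2) (z + ε • x) / ν * -2) • Matrix.of fun i j => B (X i) (X j) := by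
      ext i j
      simp only [Matrix.of_apply, Matrix.smul_apply, smul_eq_mul, hform _ (hX.2 i) _ (hX.2 j)]
      ring
    rw [blaschke_eq h.contDiff hx (h0 x hx) hX, blaschkeOfFrame, hm, Matrix.det_smul,
      Fintype.card_fin, h2, hform v hv w hw]
    generalize det4 (X 0) (X 1) (X 2) (z + ε • x) = D at *
    have hD : D ≠ 0 := by
      rintro rfl
      simp at hd0
    have e : (D / ν * -2) ^ 3 * (K * D ^ 2) = D ^ 5 * (-8 * K / ν ^ 3) := by
      field_simp
      ring
    rw [e, fifthRoot_pow_mul, ← hrdef]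
    simp only [smul_apply, smul_eq_mul]
    field_simp
  · intro x hx v hv hv0
    obtain ⟨s, hs⟩ := h.exists_definite hx (hQ.2 x hx)
    obtain ⟨X, hX⟩ := exists_isHyperFrame (h0 x hx)
    have h1 := h.mul_det_pos hX hs
    rw [(hz x hx).2 X hX] at h1
    have h2 := hs v hv hv0
    simp only [smul_apply, smul_eq_mul]
    -- `s det B(X_i, X_j) = s K D²` is positive, so `K` has the sign that makes `K B` positive on
    -- the hyperplane.
    have hsK : 0 < s * K := by
      by_contra! hneg
      have := mul_nonpos_of_nonpos_of_nonneg hneg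
        (sq_nonneg (det4 (X 0) (X 1) (X 2) (z + ε • x)))
      linarith
    have h3 : 0 < K * B v v := by
      have h4 := mul_pos hsK h2
      have : 0 < s ^ 2 * (K * B v v) := by linarith
      exact (mul_pos_iff_of_pos_left (by
        have : s ≠ 0 := left_ne_zero_of_mul hsK.ne'
        positivity)).1 this
    have e : -2 / (ν * r) * B v v = -2 * (K * B v v) / (ν * r * K) := by
      field_simp
    rw [e]
    exact div_pos_of_neg_of_neg (by linarith) hKr
  · intro ζ hζ x hx w hw
    simp [hζ.apply_eq_zero h hν h0 hd hz hx hw]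

theorem exists_isAffineNormal {Q : R4 → ℝ} (hQ : IsConvexHyperquadric Q) :
    ∃ ζ, IsAffineNormal Q ζ := by
  by_cases hne : ∃ x, Q x = 0
  · exact (hQ.exists_flat_form hne).1
  -- On an empty hyperquadric the conditions on an affine normal are vacuous.
  · exact ⟨0, fun x hx => absurd ⟨x, hx⟩ hne⟩

/-! ### Calculus on a surface -/

section Calculus

variable {M : Type*} [TopologicalSpace M] [ChartedSpace (EuclideanSpace ℝ (Fin 2)) M]
  {W : Type*} [NormedAddCommGroup W] [NormedSpace ℝ W]

/-- The model vector of a tangent vector, in the preferred chart. -/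
def modelVec (p : M) : TangentSpace (𝓡 2) p →L[ℝ] EuclideanSpace ℝ (Fin 2) :=
  ContinuousLinearMap.id ℝ (EuclideanSpace ℝ (Fin 2))

/-- The manifold derivative at `p` is the ordinary derivative read in the preferred chart at `p`.
The product rules below reduce to `fderiv` calculus through it. -/
theorem mfderiv_apply_eq {h : M → W} {p : M}
    (hh : ContMDiffAt (𝓡 2) 𝓘(ℝ, W) ∞ h p) (x : TangentSpace (𝓡 2) p) :
    mfderiv (𝓡 2) 𝓘(ℝ, W) h p x =
      fderiv ℝ (h ∘ (extChartAt (𝓡 2) p).symm) (extChartAt (𝓡 2) p p) (modelVec p x) := by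
  have h1 := (hh.mdifferentiableAt (by simp)).hasMFDerivAt.2
  rw [ModelWithCorners.range_eq_univ] at h1
  let T : EuclideanSpace ℝ (Fin 2) →L[ℝ] W := mfderiv (𝓡 2) 𝓘(ℝ, W) h p
  have h2 : HasFDerivWithinAt (h ∘ (extChartAt (𝓡 2) p).symm) T Set.univ
    (extChartAt (𝓡 2) p p) := h1
  rw [(hasFDerivWithinAt_univ.1 h2).fderiv]
  rfl

theorem contDiffAt_comp_extChartAt_symm {h : M → W} {p : M}
    (hh : ContMDiffAt (𝓡 2) 𝓘(ℝ, W) ∞ h p) :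
    ContDiffAt ℝ ∞ (h ∘ (extChartAt (𝓡 2) p).symm) (extChartAt (𝓡 2) p p) := by
  have := (contMDiffAt_iff.1 hh).2
  rwa [ModelWithCorners.range_eq_univ, contDiffWithinAt_univ] at this

theorem dmap_apply {h : M → R4} {p : M} (hh : ContMDiffAt (𝓡 2) 𝓘(ℝ, R4) ∞ h p)
    (x : TangentSpace (𝓡 2) p) : dmap h p x =
      fderiv ℝ (h ∘ (extChartAt (𝓡 2) p).symm) (extChartAt (𝓡 2) p p) (modelVec p x) :=
  mfderiv_apply_eq hh x

theorem dfun_apply {h : M → ℝ} {p : M} (hh : ContMDiffAt (𝓡 2) 𝓘(ℝ, ℝ) ∞ h p)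
    (x : TangentSpace (𝓡 2) p) : dfun h p x =
      fderiv ℝ (h ∘ (extChartAt (𝓡 2) p).symm) (extChartAt (𝓡 2) p p) (modelVec p x) :=
  mfderiv_apply_eq hh x

theorem dfun_congr {h k : M → ℝ} {p : M} (hhk : h =ᶠ[𝓝 p] k) : dfun h p = dfun k p :=
  hhk.mfderiv_eq

theorem dfun_const (c : ℝ) (p : M) : dfun (fun _ : M => c) p = 0 := by
  rw [dfun, mfderiv_const]
  rfl

theorem contMDiffAt_bilin (β : R4 →L[ℝ] R4 →L[ℝ] ℝ) {U V : M → R4} {p : M}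
    (hU : ContMDiffAt (𝓡 2) 𝓘(ℝ, R4) ∞ U p) (hV : ContMDiffAt (𝓡 2) 𝓘(ℝ, R4) ∞ V p) :
    ContMDiffAt (𝓡 2) 𝓘(ℝ, ℝ) ∞ (fun q => β (U q) (V q)) p :=
  (β.contMDiff.contMDiffAt.comp p hU).clm_apply hV

theorem dfun_bilin (β : R4 →L[ℝ] R4 →L[ℝ] ℝ) {U V : M → R4} {p : M}
    (hU : ContMDiffAt (𝓡 2) 𝓘(ℝ, R4) ∞ U p) (hV : ContMDiffAt (𝓡 2) 𝓘(ℝ, R4) ∞ V p)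
    (x : TangentSpace (𝓡 2) p) :
    dfun (fun q => β (U q) (V q)) p x = β (dmap U p x) (V p) + β (U p) (dmap V p x) := by
  have hU' := (contDiffAt_comp_extChartAt_symm hU).differentiableAt (by simp)
  have hV' := (contDiffAt_comp_extChartAt_symm hV).differentiableAt (by simp)
  rw [dfun_apply (contMDiffAt_bilin β hU hV), dmap_apply hU, dmap_apply hV]
  have h1 := (β.hasFDerivAt.comp _ hU'.hasFDerivAt).clm_apply hV'.hasFDerivAt
  have h2 : ((fun q => β (U q) (V q)) ∘ (extChartAt (𝓡 2) p).symm) =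
    fun z => (β ∘ (U ∘ (extChartAt (𝓡 2) p).symm)) z ((V ∘ (extChartAt (𝓡 2) p).symm) z) := rfl
  rw [h2, h1.fderiv]
  simp
  ring

theorem dfun_mul {h k : M → ℝ} {p : M} (hh : ContMDiffAt (𝓡 2) 𝓘(ℝ, ℝ) ∞ h p)
    (hk : ContMDiffAt (𝓡 2) 𝓘(ℝ, ℝ) ∞ k p) (x : TangentSpace (𝓡 2) p) :
    dfun (fun q => h q * k q) p x = dfun h p x * k p + h p * dfun k p x := by
  have hh' := (contDiffAt_comp_extChartAt_symm hh).differentiableAt (by simp)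
  have hk' := (contDiffAt_comp_extChartAt_symm hk).differentiableAt (by simp)
  have hm : ContMDiffAt (𝓡 2) 𝓘(ℝ, ℝ) ∞ (fun q => h q * k q) p := hh.mul hk
  rw [dfun_apply hm, dfun_apply hh, dfun_apply hk]
  have h1 := hh'.hasFDerivAt.mul hk'.hasFDerivAt
  have h2 : ((fun q => h q * k q) ∘ (extChartAt (𝓡 2) p).symm) =
    (h ∘ (extChartAt (𝓡 2) p).symm) * (k ∘ (extChartAt (𝓡 2) p).symm) := rfl
  rw [h2, h1.fderiv]
  simp
  ring

theorem dfun_sub {h k : M → ℝ} {p : M} (hh : ContMDiffAt (𝓡 2) 𝓘(ℝ, ℝ) ∞ h p)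
    (hk : ContMDiffAt (𝓡 2) 𝓘(ℝ, ℝ) ∞ k p) (x : TangentSpace (𝓡 2) p) :
    dfun (fun q => h q - k q) p x = dfun h p x - dfun k p x := by
  have hh' := (contDiffAt_comp_extChartAt_symm hh).differentiableAt (by simp)
  have hk' := (contDiffAt_comp_extChartAt_symm hk).differentiableAt (by simp)
  rw [dfun_apply (hh.sub hk), dfun_apply hh, dfun_apply hk]
  have h1 := hh'.hasFDerivAt.sub hk'.hasFDerivAt
  have h2 : ((fun q => h q - k q) ∘ (extChartAt (𝓡 2) p).symm) =
    (h ∘ (extChartAt (𝓡 2) p).symm) - (k ∘ (extChartAt (𝓡 2) p).symm) := rfl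
  rw [h2, h1.fderiv]
  simp

theorem IsTangentField.contMDiffAt {f : M → R4} {V : Set M}
    {Y : (q : M) → TangentSpace (𝓡 2) q} (hY : IsTangentField f V Y) (hV : IsOpen V) {p : M}
    (hp : p ∈ V) : ContMDiffAt (𝓡 2) 𝓘(ℝ, R4) ∞ (fun q => dmap f q (Y q)) p :=
  ContMDiffOn.contMDiffAt hY (hV.mem_nhds hp)

theorem isTangentField_iff {f : M → R4} {V : Set M} (hV : IsOpen V)
    {Y : (q : M) → TangentSpace (𝓡 2) q} : IsTangentField f V Y ↔
      ∀ p ∈ V, ContMDiffAt (𝓡 2) 𝓘(ℝ, R4) ∞ (fun q => dmap f q (Y q)) p :=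
  ⟨fun h _ hp => h.contMDiffAt hV hp, fun h p hp => (h p hp).contMDiffWithinAt⟩

variable [IsManifold (𝓡 2) ∞ M]

/-- Coordinate vector fields near `p`. -/
theorem exists_coordinate_fields {f : M → R4} (hf : IsSmoothImmersion f) (p : M) :
    ∃ (V : Set M) (X : (q : M) → EuclideanSpace ℝ (Fin 2) →L[ℝ] TangentSpace (𝓡 2) q),
      IsOpen V ∧ p ∈ V ∧ (∀ v, IsTangentField f V fun q => X q v) ∧
      (∀ q ∈ V, Function.Injective (X q)) ∧
      ∀ v w, flatD f p (X p v) (fun q => X q w) = flatD f p (X p w) (fun q => X q v) := by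
  have : IsManifold (𝓡 2) 1 M := IsManifold.of_le (n := ∞) (by simp)
  set φ := extChartAt (𝓡 2) p with hφ
  set F : EuclideanSpace ℝ (Fin 2) → R4 := f ∘ φ.symm with hF
  have hFs : ContDiffOn ℝ ∞ F φ.target := by
    rw [← contMDiffOn_iff_contDiffOn]
    exact hf.1.comp_contMDiffOn (contMDiffOn_extChartAt_symm p)
  have hto : IsOpen φ.target := isOpen_extChartAt_target p
  have hFa : ∀ z ∈ φ.target, ContDiffAt ℝ ∞ F z := fun z hz => hFs.contDiffAt (hto.mem_nhds hz)
  have hso : IsOpen φ.source := isOpen_extChartAt_source p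
  let D : (q : M) → TangentSpace (𝓡 2) q →L[ℝ] EuclideanSpace ℝ (Fin 2) :=
    fun q => mfderiv (𝓡 2) 𝓘(ℝ, EuclideanSpace ℝ (Fin 2)) φ q
  have hdf : ∀ q ∈ φ.source, ∀ t, dmap f q t = fderiv ℝ F (φ q) (D q t) := by
    intro q hq t
    have h1 : f =ᶠ[𝓝 q] F ∘ φ := by
      filter_upwards [hso.mem_nhds hq] with y hy
      simp [F, φ.left_inv hy]
    have hz : φ q ∈ φ.target := φ.map_source hq
    have h2 : MDifferentiableAt 𝓘(ℝ, EuclideanSpace ℝ (Fin 2)) 𝓘(ℝ, R4) F (φ q) :=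
      ((hFa _ hz).differentiableAt (by simp)).mdifferentiableAt
    have h3 : MDifferentiableAt (𝓡 2) 𝓘(ℝ, EuclideanSpace ℝ (Fin 2)) φ q :=
      mdifferentiableAt_extChartAt (by rwa [← extChartAt_source (𝓡 2)])
    have h4 := mfderiv_comp q h2 h3
    rw [mfderiv_eq_fderiv] at h4
    rw [dmap, h1.mfderiv_eq, h4]
    rfl
  -- The coordinate fields invert the derivative of the chart; outside its source the value `0` is
  -- irrelevant.
  have hX : ∀ q, ∃ Xq : EuclideanSpace ℝ (Fin 2) →L[ℝ] TangentSpace (𝓡 2) q,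
      q ∈ φ.source → ∀ v, D q (Xq v) = v := by
    intro q
    by_cases hq : q ∈ φ.source
    · obtain ⟨e, he⟩ := isInvertible_mfderiv_extChartAt (I := 𝓡 2) hq
      refine ⟨e.symm.toContinuousLinearMap, fun _ v => ?_⟩
      have h1 : D q = e.toContinuousLinearMap := he.symm
      rw [h1]
      exact e.apply_symm_apply v
    · exact ⟨0, fun h => absurd h hq⟩
  choose X hX using hX
  have hXF : ∀ q ∈ φ.source, ∀ v, dmap f q (X q v) = fderiv ℝ F (φ q) v := by
    intro q hq v
    rw [hdf q hq, hX q hq]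
  have hsm : ∀ v, IsTangentField f φ.source fun q => X q v := by
    intro v
    have h1 : ContDiffOn ℝ ∞ (fun z => fderiv ℝ F z v) φ.target := fun z hz =>
      (((hFa z hz).fderiv_right (m := ∞) (by simp)).clm_apply contDiffAt_const).contDiffWithinAt
    have h2 : ContMDiffOn (𝓡 2) 𝓘(ℝ, R4) ∞ (fun q => fderiv ℝ F (φ q) v) φ.source :=
      h1.contMDiffOn.comp (by rw [hφ, extChartAt_source]; exact contMDiffOn_extChartAt) φ.mapsTo
    exact h2.congr fun q hq => hXF q hq v
  have hpS : p ∈ φ.source := mem_extChartAt_source p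
  have hXp : ∀ v, modelVec p (X p v) = v := by
    intro v
    have h1 : D p = modelVec p := mfderiv_extChartAt_self
    rw [← h1, hX p hpS]
  refine ⟨φ.source, X, hso, hpS, hsm, ?_, ?_⟩
  · intro q hq v w hvw
    rw [← hX q hq v, hvw, hX q hq]
  -- In the chart these are second partial derivatives of the parametrization, whence the symmetry.
  · have hsnd : ∀ v w, flatD f p (X p v) (fun q => X q w) =
        fderiv ℝ (fderiv ℝ F) (φ p) v w := by
      intro v w
      rw [flatD, dmap_apply ((hsm w).contMDiffAt hso hpS), hXp]
      have h1 : ((fun q => dmap f q (X q w)) ∘ φ.symm) =ᶠ[𝓝 (φ p)] fun z => fderiv ℝ F z w := by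
        filter_upwards [hto.mem_nhds (φ.map_source hpS)] with z hz
        simp only [Function.comp_apply]
        rw [hXF _ (φ.map_target hz), φ.right_inv hz]
      rw [h1.fderiv_eq]
      have h2 : DifferentiableAt ℝ (fderiv ℝ F) (φ p) :=
        ((hFa _ (φ.map_source hpS)).fderiv_right (m := ∞) (by simp)).differentiableAt (by simp)
      rw [fderiv_clm_apply h2 (differentiableAt_const w)]
      simp
    intro v w
    rw [hsnd, hsnd]
    exact ((hFa _ (φ.map_source hpS)).isSymmSndFDerivAt
      (by simpa using (WithTop.coe_le_coe.2 (le_top : (2 : ℕ∞) ≤ ⊤)))) v w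

end Calculus

/-! ### Tangent frames, tangential projection and second fundamental forms -/

section TangentFields

variable {M : Type*} [TopologicalSpace M] [ChartedSpace (EuclideanSpace ℝ (Fin 2)) M]
  {f : M → R4} {β : R4 →L[ℝ] R4 →L[ℝ] ℝ}

theorem dmap_mem_tangentPlane (f : M → R4) (p : M) (u : TangentSpace (𝓡 2) p) :
    dmap f p u ∈ tangentPlane f p := ⟨u, rfl⟩

theorem finrank_tangentSpace (q : M) : Module.finrank ℝ (TangentSpace (𝓡 2) q) = 2 :=
  finrank_euclideanSpace_fin (𝕜 := ℝ) (n := 2)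

instance (q : M) : FiniteDimensional ℝ (TangentSpace (𝓡 2) q) :=
  inferInstanceAs (FiniteDimensional ℝ (EuclideanSpace ℝ (Fin 2)))

theorem exists_smul_add_smul {q : M} {u v : TangentSpace (𝓡 2) q}
    (h : LinearIndependent ℝ ![u, v]) (t : TangentSpace (𝓡 2) q) :
    ∃ a b : ℝ, t = a • u + b • v := by
  have h1 := h.span_eq_top_of_card_eq_finrank (by simp [finrank_tangentSpace])
  have h2 : t ∈ Submodule.span ℝ (Set.range ![u, v]) := by rw [h1]; trivial
  rw [Matrix.range_cons_cons_empty, Submodule.mem_span_pair] at h2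
  obtain ⟨a, b, hab⟩ := h2
  exact ⟨a, b, hab.symm⟩

/-- `β` restricts to a positive definite symmetric form on the tangent planes of `f`. -/
structure InducesMetric (f : M → R4) (β : R4 →L[ℝ] R4 →L[ℝ] ℝ) : Prop where
  symm : ∀ u v, β u v = β v u
  pos : ∀ (q : M) (u : TangentSpace (𝓡 2) q), u ≠ 0 → 0 < β (dmap f q u) (dmap f q u)

/-- Positivity on `β(v, v) u - β(u, v) v`, whose square is `β(v, v)` times the Gram determinant. -/
theorem InducesMetric.gram_pos (hβ : InducesMetric f β) {q : M} {u v : TangentSpace (𝓡 2) q}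
    (h : LinearIndependent ℝ ![u, v]) :
    0 < β (dmap f q u) (dmap f q u) * β (dmap f q v) (dmap f q v) -
      β (dmap f q u) (dmap f q v) ^ 2 := by
  have hv : v ≠ 0 := h.ne_zero 1
  have hvv := hβ.pos q v hv
  have hw : β (dmap f q v) (dmap f q v) • u + (-β (dmap f q u) (dmap f q v)) • v ≠ 0 := by
    intro h0
    exact hvv.ne' (LinearIndependent.pair_iff.1 h _ _ h0).1
  have h1 := hβ.pos q _ hw
  simp only [map_add, map_smul, add_apply, smul_apply, smul_eq_mul,
    hβ.symm (dmap f q v) (dmap f q u)] at h1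
  have h2 : 0 < β (dmap f q v) (dmap f q v) * (β (dmap f q u) (dmap f q u) *
    β (dmap f q v) (dmap f q v) - β (dmap f q u) (dmap f q v) ^ 2) := by linarith
  exact (mul_pos_iff_of_pos_left hvv).1 h2

/-- The component of `c` in the plane spanned by `a` and `b`, orthogonally with respect to `β`. -/
def planeProj (β : R4 →L[ℝ] R4 →L[ℝ] ℝ) (c a b : R4) : R4 :=
  (β a a * β b b - β a b ^ 2)⁻¹ •
    ((β c a * β b b - β c b * β a b) • a + (β c b * β a a - β c a * β a b) • b)

theorem contMDiffAt_comp₂ {W : Type*} [NormedAddCommGroup W] [NormedSpace ℝ W] {a b : M → R4}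
    {p : M} (ha : ContMDiffAt (𝓡 2) 𝓘(ℝ, R4) ∞ a p) (hb : ContMDiffAt (𝓡 2) 𝓘(ℝ, R4) ∞ b p)
    {g : R4 × R4 → W} (hg : ContDiffAt ℝ ∞ g (a p, b p)) :
    ContMDiffAt (𝓡 2) 𝓘(ℝ, W) ∞ (fun q => g (a q, b q)) p :=
  ContMDiffAt.comp p (g := g) (f := fun q => (a q, b q)) hg.contMDiffAt (ha.prodMk_space hb)

variable [IsManifold (𝓡 2) ∞ M]

theorem exists_tangentFrame (hf : IsSmoothImmersion f) (p : M) :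
    ∃ (V : Set M) (X₁ X₂ : (q : M) → TangentSpace (𝓡 2) q), IsOpen V ∧ p ∈ V ∧
      IsTangentField f V X₁ ∧ IsTangentField f V X₂ ∧
      (∀ q ∈ V, LinearIndependent ℝ ![X₁ q, X₂ q]) ∧
      flatD f p (X₁ p) X₂ = flatD f p (X₂ p) X₁ := by
  obtain ⟨V, X, hV, hp, hX, hinj, hs⟩ := exists_coordinate_fields hf p
  refine ⟨V, fun q => X q (EuclideanSpace.single 0 1), fun q => X q (EuclideanSpace.single 1 1),
    hV, hp, hX _, hX _, fun q hq => ?_, hs _ _⟩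
  rw [LinearIndependent.pair_iff]
  intro s t hst
  rw [← map_smul, ← map_smul, ← map_add] at hst
  have h0 := hinj q hq (hst.trans (map_zero (X q)).symm)
  have h1 := congrArg (fun z : EuclideanSpace ℝ (Fin 2) => z 0) h0
  have h2 := congrArg (fun z : EuclideanSpace ℝ (Fin 2) => z 1) h0
  exact ⟨by simpa using h1, by simpa using h2⟩

/-- The tangential component of a constant vector is a smooth tangent field. -/
theorem InducesMetric.exists_projection (hβ : InducesMetric f β) (hf : IsSmoothImmersion f)
    (c : R4) : ∃ E : (q : M) → TangentSpace (𝓡 2) q, IsTangentField f Set.univ E ∧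
      ∀ q (s : TangentSpace (𝓡 2) q), β (c - dmap f q (E q)) (dmap f q s) = 0 := by
  have hformula : ∀ q (u v : TangentSpace (𝓡 2) q), LinearIndependent ℝ ![u, v] →
      (∃ t, dmap f q t = planeProj β c (dmap f q u) (dmap f q v)) ∧
      ∀ s, β (c - planeProj β c (dmap f q u) (dmap f q v)) (dmap f q s) = 0 := by
    intro q u v huv
    refine ⟨⟨(β (dmap f q u) (dmap f q u) * β (dmap f q v) (dmap f q v) -
        β (dmap f q u) (dmap f q v) ^ 2)⁻¹ •
      ((β c (dmap f q u) * β (dmap f q v) (dmap f q v) -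
          β c (dmap f q v) * β (dmap f q u) (dmap f q v)) • u +
        (β c (dmap f q v) * β (dmap f q u) (dmap f q u) -
          β c (dmap f q u) * β (dmap f q u) (dmap f q v)) • v), ?_⟩, ?_⟩
    · simp only [map_smul, map_add, planeProj]
    · intro s
      have hΔ := (hβ.gram_pos huv).ne'
      obtain ⟨r, t, rfl⟩ := exists_smul_add_smul huv s
      simp only [planeProj, map_sub, map_add, map_smul, add_apply, sub_apply, smul_apply,
        smul_eq_mul, hβ.symm (dmap f q v) (dmap f q u)]
      field_simp
      ring
  have hex : ∀ q, ∃ t : TangentSpace (𝓡 2) q, ∀ s : TangentSpace (𝓡 2) q,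
      β (c - dmap f q t) (dmap f q s) = 0 := by
    intro q
    obtain ⟨V, X₁, X₂, -, hq, -, -, hX, -⟩ := exists_tangentFrame hf q
    obtain ⟨⟨t, ht⟩, h⟩ := hformula q _ _ (hX q hq)
    exact ⟨t, fun s => by rw [ht]; exact h s⟩
  choose E hE using hex
  refine ⟨E, (isTangentField_iff isOpen_univ).2 fun p _ => ?_, hE⟩
  obtain ⟨V, X₁, X₂, hV, hp, hX₁, hX₂, hX, -⟩ := exists_tangentFrame hf p
  -- `E` was chosen pointwise. Uniqueness of the orthogonal projection identifies it locally with
  -- the explicit formula in a smooth frame, which gives smoothness.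
  have h1 : (fun q => dmap f q (E q)) =ᶠ[𝓝 p]
      fun q => planeProj β c (dmap f q (X₁ q)) (dmap f q (X₂ q)) := by
    filter_upwards [hV.mem_nhds hp] with q hq
    obtain ⟨⟨t, ht⟩, h⟩ := hformula q _ _ (hX q hq)
    rw [← ht]
    rw [← ht] at h
    by_contra hne
    have hne' : t - E q ≠ 0 := fun h0 => hne (by rw [sub_eq_zero.1 h0])
    have h2 := hβ.pos q _ hne'
    have h3 := h (t - E q)
    have h4 := hE q (t - E q)
    simp only [map_sub, sub_apply] at h2 h3 h4
    linarith
  refine ContMDiffAt.congr_of_eventuallyEq ?_ h1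
  refine contMDiffAt_comp₂ (g := fun z : R4 × R4 => planeProj β c z.1 z.2)
    (hX₁.contMDiffAt hV hp) (hX₂.contMDiffAt hV hp) ?_
  have hΔ := (hβ.gram_pos (hX p hp)).ne'
  unfold planeProj
  have hs : ContDiffAt ℝ ∞ (fun z : R4 × R4 => β z.1 z.1 * β z.2 z.2 - β z.1 z.2 ^ 2)
    (dmap f p (X₁ p), dmap f p (X₂ p)) := by fun_prop
  exact (hs.inv hΔ).smul (by fun_prop)

/-- The second fundamental form along a conormal is tensorial and symmetric. -/
theorem exists_conormal_form (hf : IsSmoothImmersion f) {p : M} {lam : R4 →ₗ[ℝ] ℝ}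
    (hlam : ∀ v ∈ tangentPlane f p, lam v = 0) :
    ∃ Ξ : TangentSpace (𝓡 2) p →L[ℝ] R4 →L[ℝ] ℝ,
      (∀ V, IsOpen V → p ∈ V → ∀ Y, IsTangentField f V Y → ∀ x,
        lam (flatD f p x Y) = Ξ x (dmap f p (Y p))) ∧
      ∀ x y, Ξ x (dmap f p y) = Ξ y (dmap f p x) := by
  -- The Euclidean product serves as an auxiliary metric: `lam` becomes a normal vector `ν`, and `ν
  -- - E` extends it to a normal field. Differentiating `δ(ν - E, Y) = 0` moves the derivative off
  -- `Y`.
  let δ : R4 →L[ℝ] R4 →L[ℝ] ℝ := ∑ i : Fin 4,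
    (ContinuousLinearMap.proj (R := ℝ) (φ := fun _ : Fin 4 => ℝ) i).smulRight
      (ContinuousLinearMap.proj (R := ℝ) (φ := fun _ : Fin 4 => ℝ) i)
  have hδ : ∀ u v : R4, δ u v = ∑ i, u i * v i := fun u v => by simp [δ]
  have hm : InducesMetric f δ := by
    refine ⟨fun u v => ?_, fun q u hu => ?_⟩
    · rw [hδ, hδ]
      exact Finset.sum_congr rfl fun i _ => mul_comm _ _
    · have h0 : dmap f q u ≠ 0 := fun h0 => hu (hf.2 q (h0.trans (map_zero _).symm))
      obtain ⟨i, hi⟩ := Function.ne_iff.1 h0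
      rw [hδ]
      exact Finset.sum_pos' (fun j _ => mul_self_nonneg _)
        ⟨i, Finset.mem_univ _, mul_self_pos.2 hi⟩
  let ν : R4 := fun i => lam (Pi.single i 1)
  have hν : ∀ v, lam v = δ ν v := by
    intro v
    rw [hδ]
    conv_lhs => rw [← Finset.univ_sum_single v]
    rw [map_sum]
    refine Finset.sum_congr rfl fun i _ => ?_
    have : (Pi.single i (v i) : R4) = v i • Pi.single i 1 := by
      rw [← Pi.single_smul, smul_eq_mul, mul_one]
    rw [this, map_smul, smul_eq_mul, mul_comm]
  obtain ⟨E, hE, hE0⟩ := hm.exists_projection hf ν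
  have hEp : E p = 0 := by
    by_contra hne
    have h1 := hm.pos p _ hne
    have h2 := hE0 p (E p)
    rw [map_sub, sub_apply, ← hν, hlam _ (dmap_mem_tangentPlane f p _)] at h2
    linarith
  have hEs : ContMDiffAt (𝓡 2) 𝓘(ℝ, R4) ∞ (fun q => ν - dmap f q (E q)) p :=
    contMDiffAt_const.sub (hE.contMDiffAt isOpen_univ trivial)
  have key : ∀ V, IsOpen V → p ∈ V → ∀ Y, IsTangentField f V Y → ∀ x,
      lam (flatD f p x Y) =
        (-(δ.comp (dmap (fun q => ν - dmap f q (E q)) p))) x (dmap f p (Y p)) := by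
    intro V hV hp Y hY x
    have h1 := dfun_bilin δ hEs (hY.contMDiffAt hV hp) x
    have h2 : (fun q => δ (ν - dmap f q (E q)) (dmap f q (Y q))) = fun _ => 0 :=
      funext fun q => hE0 q (Y q)
    rw [h2, dfun_const, hEp, map_zero, sub_zero, ← hν] at h1
    have h3 : lam (flatD f p x Y) = -δ (dmap (fun q => ν - dmap f q (E q)) p x) (dmap f p (Y p)) :=
      by
        rw [flatD]
        simp only [zero_apply] at h1
        linarith
    rw [h3]
    rfl
  refine ⟨_, key, ?_⟩
  generalize -(δ.comp (dmap (fun q => ν - dmap f q (E q)) p)) = Ξ at key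
  obtain ⟨V, X₁, X₂, hV, hp, hX₁, hX₂, hX, hs⟩ := exists_tangentFrame hf p
  intro x y
  obtain ⟨a, b, rfl⟩ := exists_smul_add_smul (hX p hp) x
  obtain ⟨c, d, rfl⟩ := exists_smul_add_smul (hX p hp) y
  -- Symmetry need only be checked on a coordinate frame, whose flat derivatives commute.
  have h12 : Ξ (X₁ p) (dmap f p (X₂ p)) = Ξ (X₂ p) (dmap f p (X₁ p)) := by
    rw [← key V hV hp X₂ hX₂, ← key V hV hp X₁ hX₁, hs]
  simp only [map_add, map_smul, add_apply, smul_apply, smul_eq_mul, h12]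
  ring

end TangentFields

/-! ### The orthogonal plane bundle of a constant form and its metric connection -/

section OrthoBundle

variable {M : Type*} [TopologicalSpace M] [ChartedSpace (EuclideanSpace ℝ (Fin 2)) M]
  {f : M → R4} {β : R4 →L[ℝ] R4 →L[ℝ] ℝ}

/-- The bilinear form induced on the surface by `β`. -/
def inducedForm (f : M → R4) (β : R4 →L[ℝ] R4 →L[ℝ] ℝ) (q : M)
    (u v : TangentSpace (𝓡 2) q) : ℝ :=
  β (dmap f q u) (dmap f q v)

/-- The orthogonal complement of the tangent plane. -/
def orthoPlane (f : M → R4) (β : R4 →L[ℝ] R4 →L[ℝ] ℝ) (p : M) : Submodule ℝ R4 where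
  carrier := {v | ∀ w ∈ tangentPlane f p, β v w = 0}
  add_mem' {u v} hu hv w hw := by simp [hu w hw, hv w hw]
  zero_mem' w _ := by simp
  smul_mem' r v hv w hw := by simp [hv w hw]

theorem mem_orthoPlane {p : M} {v : R4} :
    v ∈ orthoPlane f β p ↔ ∀ w ∈ tangentPlane f p, β v w = 0 := Iff.rfl

theorem mem_orthoPlane_iff {p : M} {v : R4} :
    v ∈ orthoPlane f β p ↔ ∀ s : TangentSpace (𝓡 2) p, β v (dmap f p s) = 0 :=
  ⟨fun h s => h _ ⟨s, rfl⟩, by rintro h _ ⟨s, rfl⟩; exact h s⟩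

theorem IsTangentField.mono {V V' : Set M} {Y : (q : M) → TangentSpace (𝓡 2) q}
    (hY : IsTangentField f V Y) (h : V' ⊆ V) : IsTangentField f V' Y :=
  ContMDiffOn.mono hY h

/-- Transversality guarantees that the defining property of `nabla` holds, instead of its default
value `0`. -/
theorem nabla_spec {σ : M → Submodule ℝ R4} {p : M} (hσ : IsCompl (tangentPlane f p) (σ p))
    (x : TangentSpace (𝓡 2) p) (Y : (q : M) → TangentSpace (𝓡 2) q) :
    flatD f p x Y - dmap f p (nabla f σ p x Y) ∈ σ p := by
  have h : ∃ t : TangentSpace (𝓡 2) p, flatD f p x Y - dmap f p t ∈ σ p := by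
    have h1 : flatD f p x Y ∈ tangentPlane f p ⊔ σ p := by
      rw [hσ.sup_eq_top]
      trivial
    obtain ⟨_, ⟨t, rfl⟩, s, hs, hts⟩ := Submodule.mem_sup.1 h1
    refine ⟨t, ?_⟩
    rw [← hts]
    simpa using hs
  rw [nabla, dif_pos h]
  exact h.choose_spec

theorem alternating_combination {q : M} (α : TangentSpace (𝓡 2) q [⋀^Fin 2]→ₗ[ℝ] ℝ)
    (u v : TangentSpace (𝓡 2) q) (a b c d : ℝ) :
    α ![a • u + b • v, c • u + d • v] = (a * d - b * c) * α ![u, v] := by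
  have hadd : ∀ x y z : TangentSpace (𝓡 2) q, α ![x + y, z] = α ![x, z] + α ![y, z] :=
    fun x y z => α.toMultilinearMap.cons_add ![z] x y
  have hsmul : ∀ (r : ℝ) (x z : TangentSpace (𝓡 2) q), α ![r • x, z] = r * α ![x, z] :=
    fun r x z => α.toMultilinearMap.cons_smul ![z] r x
  have hswap : ∀ x z : TangentSpace (𝓡 2) q, α ![z, x] = -α ![x, z] := by
    intro x z
    rw [← α.map_swap ![x, z] (i := 0) (j := 1) (by simp)]
    congr 1
    ext i
    fin_cases i <;> rfl
  have hself : ∀ x : TangentSpace (𝓡 2) q, α ![x, x] = 0 := fun x =>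
    α.map_eq_zero_of_eq ![x, x] (i := 0) (j := 1) rfl (by simp)
  rw [hadd, hsmul, hsmul, hswap _ u, hswap _ v, hadd, hadd, hsmul, hsmul, hsmul, hsmul, hself,
    hself, hswap u v]
  ring

theorem finrank_tangentPlane (hf : IsSmoothImmersion f) (p : M) :
    Module.finrank ℝ (tangentPlane f p) = 2 := by
  rw [tangentPlane, LinearMap.finrank_range_of_inj (hf.2 p)]
  exact finrank_tangentSpace p

theorem contMDiffAt_inducedForm {V : Set M} (hV : IsOpen V) {p : M} (hp : p ∈ V)
    {Y Z : (q : M) → TangentSpace (𝓡 2) q}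
    (hY : IsTangentField f V Y) (hZ : IsTangentField f V Z) :
    ContMDiffAt (𝓡 2) 𝓘(ℝ, ℝ) ∞ (fun q => inducedForm f β q (Y q) (Z q)) p :=
  contMDiffAt_bilin β (hY.contMDiffAt hV hp) (hZ.contMDiffAt hV hp)

variable [IsManifold (𝓡 2) ∞ M]

/-- The product of two values of an area form is a Gram determinant. -/
theorem InducesMetric.area_mul_area (hβ : InducesMetric f β) (hf : IsSmoothImmersion f)
    {V : Set M} {α : (q : M) → TangentSpace (𝓡 2) q [⋀^Fin 2]→ₗ[ℝ] ℝ}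
    (hα : IsAreaForm f (inducedForm f β) V α) {q : M} (hq : q ∈ V)
    (u v w z : TangentSpace (𝓡 2) q) :
    α q ![u, v] * α q ![w, z] =
      inducedForm f β q u w * inducedForm f β q v z -
        inducedForm f β q u z * inducedForm f β q v w := by
  obtain ⟨V', X₁, X₂, -, hq', -, -, hX, -⟩ := exists_tangentFrame hf q
  obtain ⟨a, b, rfl⟩ := exists_smul_add_smul (hX q hq') u
  obtain ⟨c, d, rfl⟩ := exists_smul_add_smul (hX q hq') v
  obtain ⟨a', b', rfl⟩ := exists_smul_add_smul (hX q hq') w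
  obtain ⟨c', d', rfl⟩ := exists_smul_add_smul (hX q hq') z
  have h1 := hβ.gram_pos (hX q hq')
  -- An area form is known only up to sign, which disappears in products of two values.
  have h2 : α q ![X₁ q, X₂ q] ^ 2 = inducedForm f β q (X₁ q) (X₁ q) *
      inducedForm f β q (X₂ q) (X₂ q) - inducedForm f β q (X₁ q) (X₂ q) ^ 2 := by
    rw [← sq_abs, hα.1 q hq, Real.sq_sqrt (abs_nonneg _)]
    exact abs_of_pos h1
  rw [alternating_combination, alternating_combination]
  have h3 : (a * d - b * c) * α q ![X₁ q, X₂ q] * ((a' * d' - b' * c') * α q ![X₁ q, X₂ q]) =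
    (a * d - b * c) * (a' * d' - b' * c') * α q ![X₁ q, X₂ q] ^ 2 := by ring
  rw [h3, h2]
  simp only [inducedForm, map_add, map_smul, add_apply, smul_apply, smul_eq_mul,
    hβ.symm (dmap f q (X₂ q)) (dmap f q (X₁ q))]
  ring

theorem InducesMetric.isCompl_orthoPlane (hβ : InducesMetric f β) (hf : IsSmoothImmersion f)
    (p : M) : IsCompl (tangentPlane f p) (orthoPlane f β p) := by
  constructor
  · rw [Submodule.disjoint_def]
    rintro _ ⟨u, rfl⟩ hu
    by_contra hne
    have hu0 : u ≠ 0 := by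
      rintro rfl
      simp at hne
    exact (hβ.pos p u hu0).ne' (hu _ ⟨u, rfl⟩)
  · rw [codisjoint_iff, eq_top_iff]
    intro c _
    obtain ⟨E, -, hE⟩ := hβ.exists_projection hf c
    have := Submodule.add_mem_sup (dmap_mem_tangentPlane f p (E p))
      (mem_orthoPlane_iff.2 (hE p))
    simpa using this

/-- A basis of the orthogonal plane at `p` is frozen as constant vectors and its tangential parts
are subtracted. At `p` nothing changes, and independence is an open condition. -/
theorem InducesMetric.isTransversalBundle (hβ : InducesMetric f β) (hf : IsSmoothImmersion f) :
    IsTransversalBundle f Set.univ (orthoPlane f β) := by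
  intro p _
  refine ⟨hβ.isCompl_orthoPlane hf p, ?_⟩
  have h2 : ∀ q, Module.finrank ℝ (orthoPlane f β q) = 2 := by
    intro q
    have h := Submodule.finrank_add_eq_of_isCompl (hβ.isCompl_orthoPlane hf q)
    rw [finrank_tangentPlane hf, Module.finrank_fin_fun] at h
    omega
  let b := Module.finBasisOfFinrankEq ℝ _ (h2 p)
  have hbi := b.linearIndependent.map' (orthoPlane f β p).subtype (Submodule.ker_subtype _)
  have hE := fun i => hβ.exists_projection hf (b i : R4)
  choose E hE hE0 using hE
  have hEp : ∀ i, E i p = 0 := by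
    intro i
    by_contra hne
    have h1 := hE0 i p (E i p)
    have h3 := mem_orthoPlane_iff.1 (b i).2 (E i p)
    have h4 := hβ.pos p _ hne
    rw [map_sub, sub_apply, h3] at h1
    linarith
  let ξ : Fin 2 → M → R4 := fun i q => (b i : R4) - dmap f q (E i q)
  have hξ : ∀ i, ContMDiff (𝓡 2) 𝓘(ℝ, R4) ∞ (ξ i) := fun i q =>
    contMDiffAt_const.sub ((hE i).contMDiffAt isOpen_univ trivial)
  have hcont : Continuous fun q => fun i => ξ i q :=
    continuous_pi fun i => (hξ i).continuous
  have hopen : IsOpen {q | LinearIndependent ℝ fun i => ξ i q} :=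
    isOpen_setOfPred_linearIndependent.preimage hcont
  refine ⟨_, ξ 0, ξ 1, hopen, ?_, Set.subset_univ _, (hξ 0).contMDiffOn, (hξ 1).contMDiffOn, ?_⟩
  · have : (fun i => ξ i p) = (orthoPlane f β p).subtype ∘ b := by
      ext1 i
      simp [ξ, hEp]
    rw [Set.mem_ofPred_eq, this]
    exact hbi
  · intro q hq
    have hr : ({ξ 0 q, ξ 1 q} : Set R4) = Set.range fun i => ξ i q := by
      ext y
      simp [Fin.exists_fin_two, eq_comm]
    rw [hr]
    symm
    apply Submodule.eq_of_le_of_finrank_eq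
    · rw [Submodule.span_le]
      rintro _ ⟨i, rfl⟩
      exact mem_orthoPlane_iff.2 (hE0 i q)
    · rw [finrank_span_eq_card hq, h2]
      rfl

/-- The orthogonal plane bundle induces a metric connection. -/
theorem InducesMetric.dfun_inducedForm (hβ : InducesMetric f β) (hf : IsSmoothImmersion f)
    {V : Set M} (hV : IsOpen V) {p : M} (hp : p ∈ V) {Y Z : (q : M) → TangentSpace (𝓡 2) q}
    (hY : IsTangentField f V Y) (hZ : IsTangentField f V Z) (x : TangentSpace (𝓡 2) p) :
    dfun (fun q => inducedForm f β q (Y q) (Z q)) p x =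
      inducedForm f β p (nabla f (orthoPlane f β) p x Y) (Z p) +
        inducedForm f β p (Y p) (nabla f (orthoPlane f β) p x Z) := by
  have h1 := dfun_bilin β (hY.contMDiffAt hV hp) (hZ.contMDiffAt hV hp) x
  have hc := hβ.isCompl_orthoPlane hf p
  -- In the product rule for the constant form `β`, the transversal part of `D_x Y` drops out
  -- because it is orthogonal to `Z`.
  have h2 := mem_orthoPlane_iff.1 (nabla_spec hc x Y) (Z p)
  have h3 := mem_orthoPlane_iff.1 (nabla_spec hc x Z) (Y p)
  rw [hβ.symm] at h3
  rw [map_sub, sub_apply] at h2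
  rw [map_sub] at h3
  simp only [inducedForm]
  rw [h1]
  simp only [flatD] at h2 h3
  linarith

theorem InducesMetric.nablaForm_eq_zero (hβ : InducesMetric f β) (hf : IsSmoothImmersion f)
    {V : Set M} (hV : IsOpen V) {p : M} (hp : p ∈ V) {Y Z : (q : M) → TangentSpace (𝓡 2) q}
    (hY : IsTangentField f V Y) (hZ : IsTangentField f V Z) (x : TangentSpace (𝓡 2) p) :
    nablaForm f (orthoPlane f β) (inducedForm f β) p x Y Z = 0 := by
  rw [nablaForm, hβ.dfun_inducedForm hf hV hp hY hZ]
  ring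

/-- Products of two values of an area form are Gram determinants of a parallel metric, so `(∇α)(Y,
Z) α(W, U) + α(Y, Z) (∇α)(W, U) = 0`. Equal pairs forming a frame at the point give `∇α = 0` on that
frame, and then on every pair. -/
theorem InducesMetric.isEquiaffine (hβ : InducesMetric f β) (hf : IsSmoothImmersion f) :
    IsEquiaffine f (inducedForm f β) Set.univ (orthoPlane f β) := by
  intro V hV _ α hα Y Z hY hZ p hp x
  have key : ∀ Y Z W U : (q : M) → TangentSpace (𝓡 2) q, IsTangentField f V Y →
      IsTangentField f V Z → IsTangentField f V W → IsTangentField f V U →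
      nablaForm f (orthoPlane f β) (fun q u v => α q ![u, v]) p x Y Z * α p ![W p, U p] +
        α p ![Y p, Z p] *
          nablaForm f (orthoPlane f β) (fun q u v => α q ![u, v]) p x W U = 0 := by
    intro Y Z W U hY hZ hW hU
    have hs : ∀ Y Z, IsTangentField f V Y → IsTangentField f V Z →
        ContMDiffAt (𝓡 2) 𝓘(ℝ, ℝ) ∞ (fun q => α q ![Y q, Z q]) p := fun Y Z hY hZ =>
      (hα.2 Y Z hY hZ).contMDiffAt (hV.mem_nhds hp)
    have h1 : (fun q => α q ![Y q, Z q] * α q ![W q, U q]) =ᶠ[𝓝 p] fun q =>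
        inducedForm f β q (Y q) (W q) * inducedForm f β q (Z q) (U q) -
          inducedForm f β q (Y q) (U q) * inducedForm f β q (Z q) (W q) := by
      filter_upwards [hV.mem_nhds hp] with q hq
      exact hβ.area_mul_area hf hα hq _ _ _ _
    have h2 := congrArg (fun T : TangentSpace (𝓡 2) p →L[ℝ] ℝ => T x) (dfun_congr h1)
    have hi := fun Y Z (hY : IsTangentField f V Y) (hZ : IsTangentField f V Z) =>
      contMDiffAt_inducedForm (β := β) hV hp hY hZ
    have hm := fun Y Z W U (hY : IsTangentField f V Y) (hZ : IsTangentField f V Z)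
        (hW : IsTangentField f V W) (hU : IsTangentField f V U) =>
      show ContMDiffAt (𝓡 2) 𝓘(ℝ, ℝ) ∞
        (fun q => inducedForm f β q (Y q) (Z q) * inducedForm f β q (W q) (U q)) p from
      (hi Y Z hY hZ).mul (hi W U hW hU)
    rw [dfun_mul (hs Y Z hY hZ) (hs W U hW hU),
      dfun_sub (hm Y W Z U hY hW hZ hU) (hm Y U Z W hY hU hZ hW),
      dfun_mul (hi Y W hY hW) (hi Z U hZ hU), dfun_mul (hi Y U hY hU) (hi Z W hZ hW),
      hβ.dfun_inducedForm hf hV hp hY hW, hβ.dfun_inducedForm hf hV hp hZ hU,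
      hβ.dfun_inducedForm hf hV hp hY hU, hβ.dfun_inducedForm hf hV hp hZ hW] at h2
    have a1 := hβ.area_mul_area hf hα hp (nabla f (orthoPlane f β) p x Y) (Z p) (W p) (U p)
    have a2 := hβ.area_mul_area hf hα hp (Y p) (nabla f (orthoPlane f β) p x Z) (W p) (U p)
    have a3 := hβ.area_mul_area hf hα hp (Y p) (Z p) (nabla f (orthoPlane f β) p x W) (U p)
    have a4 := hβ.area_mul_area hf hα hp (Y p) (Z p) (W p) (nabla f (orthoPlane f β) p x U)
    simp only [nablaForm]
    linear_combination h2 - a1 - a2 - a3 - a4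
  obtain ⟨V', X₁, X₂, -, hp', -, -, hX, -⟩ := exists_tangentFrame hf p
  -- The identity needs fields on all of `V`, where a local frame may not exist; projections of
  -- constant vectors are global and take any prescribed value at `p`.
  have hE : ∀ u : TangentSpace (𝓡 2) p, ∃ E, IsTangentField f V E ∧ E p = u := by
    intro u
    obtain ⟨E, hE, hE0⟩ := hβ.exists_projection hf (dmap f p u)
    refine ⟨E, hE.mono (Set.subset_univ _), ?_⟩
    by_contra hne
    have h1 := hβ.pos p _ (sub_ne_zero.2 (Ne.symm hne))
    have h2 := hE0 p (u - E p)
    rw [← map_sub] at h2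
    exact h1.ne' h2
  obtain ⟨E₁, hE₁, h₁⟩ := hE (X₁ p)
  obtain ⟨E₂, hE₂, h₂⟩ := hE (X₂ p)
  have hne : α p ![E₁ p, E₂ p] ≠ 0 := by
    rw [h₁, h₂, ← abs_pos, hα.1 p hp]
    exact Real.sqrt_pos.2 (abs_pos.2 (hβ.gram_pos (hX p hp')).ne')
  have h3 := key E₁ E₂ E₁ E₂ hE₁ hE₂ hE₁ hE₂
  have h4 : nablaForm f (orthoPlane f β) (fun q u v => α q ![u, v]) p x E₁ E₂ = 0 := by
    rw [mul_comm, ← two_mul] at h3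
    simpa [hne] using h3
  have h5 := key Y Z E₁ E₂ hY hZ hE₁ hE₂
  rw [h4, mul_zero, add_zero] at h5
  exact (mul_eq_zero.1 h5).resolve_right hne

theorem InducesMetric.isAntisymmetricEquiaffine (hβ : InducesMetric f β)
    (hf : IsSmoothImmersion f) :
    IsAntisymmetricEquiaffine f (inducedForm f β) Set.univ (orthoPlane f β) := by
  refine ⟨hβ.isTransversalBundle hf, hβ.isEquiaffine hf, ?_⟩
  intro V hV _ X₁ X₂ ⟨h₁, h₂, _⟩ p hp
  simp [hβ.nablaForm_eq_zero hf hV hp, h₁, h₂]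

theorem InducesMetric.isSymmetricEquiaffine (hβ : InducesMetric f β)
    (hf : IsSmoothImmersion f) :
    IsSymmetricEquiaffine f (inducedForm f β) Set.univ (orthoPlane f β) := by
  refine ⟨hβ.isTransversalBundle hf, hβ.isEquiaffine hf, ?_⟩
  intro V hV _ X₁ X₂ ⟨h₁, h₂, _⟩ p hp
  simp [hβ.nablaForm_eq_zero hf hV hp, h₁, h₂]

end OrthoBundle

/-! ### Determinants, conormals and metric fields of surfaces in a quadric -/

theorem dfun_comp {M : Type*} [TopologicalSpace M] [ChartedSpace (EuclideanSpace ℝ (Fin 2)) M]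
    {φ : R4 → ℝ} (hφ : ContDiff ℝ ∞ φ) {U : M → R4} {p : M}
    (hU : ContMDiffAt (𝓡 2) 𝓘(ℝ, R4) ∞ U p) (x : TangentSpace (𝓡 2) p) :
    dfun (fun q => φ (U q)) p x = fderiv ℝ φ (U p) (dmap U p x) := by
  have hU' := (contDiffAt_comp_extChartAt_symm hU).differentiableAt (by simp)
  have hφU : ContMDiffAt (𝓡 2) 𝓘(ℝ, ℝ) ∞ (fun q => φ (U q)) p :=
    hφ.contMDiff.contMDiffAt.comp p hU
  rw [dfun_apply hφU, dmap_apply hU]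
  have h1 : ((fun q => φ (U q)) ∘ (extChartAt (𝓡 2) p).symm) =
    φ ∘ (U ∘ (extChartAt (𝓡 2) p).symm) := rfl
  rw [h1, fderiv_comp _ (hφ.differentiable (by simp)).differentiableAt hU']
  simp

theorem contDiff_det4 {E : Type*} [NormedAddCommGroup E] [NormedSpace ℝ E] {a b c d : E → R4}
    (ha : ContDiff ℝ ∞ a) (hb : ContDiff ℝ ∞ b) (hc : ContDiff ℝ ∞ c) (hd : ContDiff ℝ ∞ d) :
    ContDiff ℝ ∞ fun z => det4 (a z) (b z) (c z) (d z) := by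
  have he : ∀ i j : Fin 4, ContDiff ℝ ∞ fun z =>
      (Matrix.of ![a z, b z, c z, d z] : Matrix (Fin 4) (Fin 4) ℝ) i j := by
    intro i j
    fin_cases i
    · exact contDiff_pi.1 ha j
    · exact contDiff_pi.1 hb j
    · exact contDiff_pi.1 hc j
    · exact contDiff_pi.1 hd j
  simp only [det4, Matrix.det_apply']
  exact ContDiff.sum fun σ _ => contDiff_const.mul (contDiff_prod fun i _ => he _ _)

/-- A linear functional vanishing on `a`, `b` and `d` is a multiple of `[a, b, ·, d]`. -/
theorem det4_mul_apply (L : R4 →L[ℝ] ℝ) {a b d : R4} (ha : L a = 0) (hb : L b = 0) (hd : L d = 0)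
    (v n : R4) : det4 a b v d * L n = det4 a b n d * L v := by
  have hL : ∀ u : R4, L u = u 0 * L (Pi.single 0 1) + u 1 * L (Pi.single 1 1) +
      u 2 * L (Pi.single 2 1) + u 3 * L (Pi.single 3 1) := by
    intro u
    have hs : ∀ i, (Pi.single i (u i) : R4) = u i • Pi.single i 1 := fun i => by
      rw [← Pi.single_smul, smul_eq_mul, mul_one]
    conv_lhs => rw [← Finset.univ_sum_single u]
    simp only [Fin.sum_univ_four, hs, map_add, map_smul, smul_eq_mul]
  rw [hL] at ha hb hd
  rw [hL n, hL v]
  generalize L (Pi.single 0 1) = l0 at *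
  generalize L (Pi.single 1 1) = l1 at *
  generalize L (Pi.single 2 1) = l2 at *
  generalize L (Pi.single 3 1) = l3 at *
  have expand : ∀ a b w d : R4, det4 a b w d =
      a 0 * (b 1 * (w 2 * d 3 - w 3 * d 2) - b 2 * (w 1 * d 3 - w 3 * d 1) +
        b 3 * (w 1 * d 2 - w 2 * d 1)) -
      a 1 * (b 0 * (w 2 * d 3 - w 3 * d 2) - b 2 * (w 0 * d 3 - w 3 * d 0) +
        b 3 * (w 0 * d 2 - w 2 * d 0)) +
      a 2 * (b 0 * (w 1 * d 3 - w 3 * d 1) - b 1 * (w 0 * d 3 - w 3 * d 0) +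
        b 3 * (w 0 * d 1 - w 1 * d 0)) -
      a 3 * (b 0 * (w 1 * d 2 - w 2 * d 1) - b 1 * (w 0 * d 2 - w 2 * d 0) +
        b 2 * (w 0 * d 1 - w 1 * d 0)) := by
    intro a b w d
    simp [det4, Matrix.det_succ_row_zero, Fin.sum_univ_succ, Fin.succAbove]
    ring
  -- Five vectors of a 4-dimensional space satisfy a linear relation with determinants as
  -- coefficients. Applying `L` to it leaves only the terms in `v` and `n`.
  have h := congrArg₂ (· + ·) (congrArg (-det4 b v d n * ·) ha)
    (congrArg₂ (· + ·) (congrArg (det4 a v d n * ·) hb) (congrArg (det4 a b v n * ·) hd))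
  simp only [expand, mul_zero, add_zero] at h ⊢
  linear_combination h

section Quadric

variable {M : Type*} [TopologicalSpace M] [ChartedSpace (EuclideanSpace ℝ (Fin 2)) M]
  {f : M → R4} {β : R4 →L[ℝ] R4 →L[ℝ] ℝ} {Q : R4 → ℝ} {ρ : ℝ}

/-- `f` is an immersed surface in the regular quadric `{Q = 0}`, whose second derivative is
proportional to a form `β` that induces a metric on the surface. -/
structure IsQuadricSurface (f : M → R4) (Q : R4 → ℝ) (β : R4 →L[ℝ] R4 →L[ℝ] ℝ) (ρ : ℝ) :
    Prop where
  immersion : IsSmoothImmersion f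
  contDiff : ContDiff ℝ ∞ Q
  mem : ∀ p, Q (f p) = 0
  regular : ∀ p, fderiv ℝ Q (f p) ≠ 0
  fderiv_eq : ∃ l : R4 →L[ℝ] ℝ, ∀ x v, fderiv ℝ Q x v = ρ * β x v + l v
  rho_ne_zero : ρ ≠ 0
  metric : InducesMetric f β

theorem fderiv_dmap_eq_zero (hf : IsSmoothImmersion f) (hQ : ContDiff ℝ ∞ Q)
    (hfQ : ∀ p, Q (f p) = 0) (p : M) (u : TangentSpace (𝓡 2) p) :
    fderiv ℝ Q (f p) (dmap f p u) = 0 := by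
  rw [← dfun_comp hQ hf.1.contMDiffAt, funext hfQ, dfun_const]
  rfl

namespace IsQuadricSurface

/-- Differentiating `dQ(Y) = 0` along the surface: the second fundamental form along the conormal
`dQ` is `-ρ g`. -/
theorem fderiv_flatD (h : IsQuadricSurface f Q β ρ) {V : Set M} (hV : IsOpen V) {p : M}
    (hp : p ∈ V) {Y : (q : M) → TangentSpace (𝓡 2) q} (hY : IsTangentField f V Y)
    (x : TangentSpace (𝓡 2) p) :
    fderiv ℝ Q (f p) (flatD f p x Y) = -ρ * inducedForm f β p x (Y p) := by
  obtain ⟨l, hl⟩ := h.fderiv_eq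
  obtain ⟨l', hl'⟩ : ∃ l' : R4 →L[ℝ] ℝ, ∀ v, l' v = -l v := ⟨-l, fun v => rfl⟩
  have hYs := hY.contMDiffAt hV hp
  have h1 : (fun q => (ρ • β) (f q) (dmap f q (Y q))) = fun q => l' (dmap f q (Y q)) := by
    funext q
    have := fderiv_dmap_eq_zero h.immersion h.contDiff h.mem q (Y q)
    rw [hl] at this
    simp only [smul_apply, smul_eq_mul, hl']
    linarith
  have h2 := dfun_bilin (ρ • β) h.immersion.1.contMDiffAt hYs x
  have h3 := dfun_comp (φ := l') l'.contDiff hYs x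
  rw [l'.fderiv, hl'] at h3
  rw [h1, h3] at h2
  rw [hl, inducedForm, flatD]
  simp only [smul_apply, smul_eq_mul] at h2
  linarith

variable [IsManifold (𝓡 2) ∞ M]

/-- If `ξ` is tangent to the quadric and transversal to the surface, then `[X₁, X₂, ·, ξ]` is a
multiple of `dQ`, so its second fundamental form is a multiple of `g`; only a scale has to be
adjusted. -/
theorem exists_metricField (h : IsQuadricSurface f Q β ρ) (p : M) :
    ∃ U X₁ X₂ ξ, IsOpen U ∧ p ∈ U ∧ IsMetricField f U X₁ X₂ ξ ∧
      ∀ V, IsOpen V → V ⊆ U → ∀ Y, IsTangentField f V Y → ∀ q ∈ V,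
        ∀ z : TangentSpace (𝓡 2) q,
          transversalMetric f X₁ X₂ ξ q Y z = inducedForm f β q (Y q) z := by
  have hf := h.immersion
  obtain ⟨V₀, X₁, X₂, hV₀, hp₀, hX₁, hX₂, hX, -⟩ := exists_tangentFrame hf p
  obtain ⟨n, hn⟩ := IsQuadricWith.exists_fderiv_eq_one (h.regular p)
  have htan := fderiv_dmap_eq_zero hf h.contDiff h.mem
  obtain ⟨m, hm, hmT⟩ : ∃ m, fderiv ℝ Q (f p) m = 0 ∧ m ∉ tangentPlane f p := by
    by_contra! hall
    obtain ⟨Z, hZ, hZt⟩ := exists_isHyperFrame (h.regular p)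
    have h1 : Submodule.span ℝ (Set.range Z) ≤ tangentPlane f p := by
      rw [Submodule.span_le]
      rintro _ ⟨i, rfl⟩
      exact hall _ (hZt i)
    have h2 := Submodule.finrank_mono h1
    rw [finrank_span_eq_card hZ, finrank_tangentPlane hf, Fintype.card_fin] at h2
    omega
  -- This is tangent to the quadric at every point of the surface and equals `m` at `p`.
  let ξ₀ : M → R4 := fun q => fderiv ℝ Q (f q) n • m - fderiv ℝ Q (f q) m • n
  have hdQ : ∀ v, ContMDiff (𝓡 2) 𝓘(ℝ, ℝ) ∞ fun q => fderiv ℝ Q (f q) v := fun v =>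
    ((h.contDiff.fderiv_right (m := ∞) (by simp)).clm_apply contDiff_const).contMDiff.comp hf.1
  have hξ₀ : ContMDiff (𝓡 2) 𝓘(ℝ, R4) ∞ ξ₀ :=
    ((hdQ n).smul contMDiff_const).sub ((hdQ m).smul contMDiff_const)
  have hξt : ∀ q, fderiv ℝ Q (f q) (ξ₀ q) = 0 := fun q => by
    simp only [ξ₀, map_sub, map_smul, smul_eq_mul]
    ring
  let k : M → ℝ := fun q => det4 (dmap f q (X₁ q)) (dmap f q (X₂ q)) n (ξ₀ q)
  have hk : ∀ q ∈ V₀, ContMDiffAt (𝓡 2) 𝓘(ℝ, ℝ) ∞ k q := by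
    intro q hq
    have hg : ContDiff ℝ ∞ fun z : R4 × R4 × R4 => det4 z.1 z.2.1 n z.2.2 :=
      contDiff_det4 contDiff_fst (contDiff_fst.comp contDiff_snd) contDiff_const
        (contDiff_snd.comp contDiff_snd)
    exact ContMDiffAt.comp q (g := fun z : R4 × R4 × R4 => det4 z.1 z.2.1 n z.2.2)
      (f := fun q => (dmap f q (X₁ q), dmap f q (X₂ q), ξ₀ q)) hg.contMDiff.contMDiffAt
      ((hX₁.contMDiffAt hV₀ hq).prodMk_space
        ((hX₂.contMDiffAt hV₀ hq).prodMk_space hξ₀.contMDiffAt))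
  have hkp : k p ≠ 0 := by
    intro h0
    have hξp : ξ₀ p = m := by simp [ξ₀, hn, hm]
    obtain ⟨c, hc, hc0⟩ := Matrix.exists_vecMul_eq_zero_iff.2 h0
    have e : c 0 • dmap f p (X₁ p) + c 1 • dmap f p (X₂ p) + c 2 • n + c 3 • m = 0 := by
      rw [← hc0, hξp]
      ext i
      simp [Matrix.vecMul, dotProduct, Fin.sum_univ_four]
    have e2 := congrArg (fderiv ℝ Q (f p)) e
    simp only [map_add, map_smul, htan, hn, hm, map_zero, smul_eq_mul, mul_zero, add_zero, zero_add,
      mul_one] at e2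
    rw [e2, zero_smul, add_zero, ← map_smul, ← map_smul, ← map_add] at e
    have e3 : c 3 = 0 := by
      by_contra h3
      refine hmT ⟨-(c 3)⁻¹ • (c 0 • X₁ p + c 1 • X₂ p), ?_⟩
      have e4 : c 3 • m = -dmap f p (c 0 • X₁ p + c 1 • X₂ p) := by
        rw [eq_neg_iff_add_eq_zero, add_comm, e]
      change dmap f p _ = m
      rw [map_smul, neg_smul, ← smul_neg, ← e4, smul_smul, inv_mul_cancel₀ h3, one_smul]
    rw [e3, zero_smul, add_zero] at e
    have e5 := LinearIndependent.pair_iff.1 (hX p hp₀) _ _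
      (hf.2 p (e.trans (map_zero (dmap f p)).symm))
    apply hc
    ext i
    fin_cases i
    · exact e5.1
    · exact e5.2
    · exact e2
    · exact e3
  obtain ⟨U, hU, hUo, hpU⟩ := eventually_nhds_iff.1
    ((hV₀.eventually_mem hp₀).and ((((hk p hp₀).continuousAt).eventually_ne hkp).and
      ((hdQ n).continuous.continuousAt.eventually_ne (y := 0) (by rw [hn]; exact one_ne_zero))))
  let Δ : M → ℝ := fun q => inducedForm f β q (X₁ q) (X₁ q) * inducedForm f β q (X₂ q) (X₂ q) -
    inducedForm f β q (X₁ q) (X₂ q) * inducedForm f β q (X₁ q) (X₂ q)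
  have hΔ : ∀ q ∈ U, 0 < Δ q := by
    intro q hq
    have := h.metric.gram_pos (hX q (hU q hq).1)
    rw [sq] at this
    exact this
  have hΔs : ∀ q ∈ U, ContMDiffAt (𝓡 2) 𝓘(ℝ, ℝ) ∞ (fun q => Real.sqrt (Δ q)) q := by
    intro q hq
    have hqV := (hU q hq).1
    have h1 : ContMDiffAt (𝓡 2) 𝓘(ℝ, ℝ) ∞ Δ q :=
      ((contMDiffAt_inducedForm hV₀ hqV hX₁ hX₁).mul
        (contMDiffAt_inducedForm hV₀ hqV hX₂ hX₂)).sub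
          ((contMDiffAt_inducedForm hV₀ hqV hX₁ hX₂).mul
            (contMDiffAt_inducedForm hV₀ hqV hX₁ hX₂))
    exact ContMDiffAt.comp q (g := Real.sqrt) (Real.contDiffAt_sqrt (hΔ q hq).ne').contMDiffAt h1
  -- The factor makes the surface form equal to `√Δ g`. Its determinant is then `Δ * Δ = (√Δ)⁴`, and
  -- the fourth root cancels `√Δ`.
  let ξ : M → R4 := fun q =>
    (-(Real.sqrt (Δ q) * fderiv ℝ Q (f q) n) * (ρ * k q)⁻¹) • ξ₀ q
  have hξ : ContMDiffOn (𝓡 2) 𝓘(ℝ, R4) ∞ ξ U := by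
    intro q hq
    have h1 : ContMDiffAt (𝓡 2) 𝓘(ℝ, ℝ) ∞ (fun q => (ρ * k q)⁻¹) q :=
      ContMDiffAt.inv₀ (contMDiffAt_const.mul (hk q (hU q hq).1))
        (mul_ne_zero h.rho_ne_zero (hU q hq).2.1)
    exact (((((hΔs q hq).mul (hdQ n).contMDiffAt).neg).mul h1).smul
      hξ₀.contMDiffAt).contMDiffWithinAt
  have hsurf : ∀ V, IsOpen V → V ⊆ U → ∀ Y, IsTangentField f V Y → ∀ q ∈ V,
      ∀ z : TangentSpace (𝓡 2) q,
        surfaceForm f X₁ X₂ ξ q Y z = Real.sqrt (Δ q) * inducedForm f β q (Y q) z := by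
    intro V hV hVU Y hY q hq z
    have hd := det4_mul_apply (fderiv ℝ Q (f q)) (htan q (X₁ q)) (htan q (X₂ q)) (hξt q)
      (flatD f q z Y) n
    rw [h.fderiv_flatD hV hq hY] at hd
    have hsmul : ∀ (r : ℝ) (a b c d : R4), det4 a b c (r • d) = r * det4 a b c d := by
      intro r a b c d
      simp [det4, Matrix.det_succ_row_zero, Fin.sum_univ_succ, Fin.succAbove]
      ring
    have hsym : inducedForm f β q z (Y q) = inducedForm f β q (Y q) z := h.metric.symm _ _
    have hkq : k q ≠ 0 := (hU q (hVU hq)).2.1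
    have hρ := h.rho_ne_zero
    rw [surfaceForm, hsmul]
    rw [hsym] at hd
    change _ = k q * _ at hd
    field_simp
    linear_combination (-Real.sqrt (Δ q)) * hd
  refine ⟨U, X₁, X₂, ξ, hUo, hpU, ⟨hX₁.mono fun q hq => (hU q hq).1,
    hX₂.mono fun q hq => (hU q hq).1, fun q hq => hX q (hU q hq).1, hξ, ?_⟩, ?_⟩
  · intro V hV hVU Y hY q hq hYq
    rw [hsurf V hV hVU Y hY q hq]
    exact mul_pos (Real.sqrt_pos.2 (hΔ q (hVU hq))) (h.metric.pos q _ hYq)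
  · intro V hV hVU Y hY q hq z
    have hqU := hVU hq
    have hs₁ := hsurf U hUo subset_rfl X₁ (hX₁.mono fun q hq => (hU q hq).1) q hqU
    have hs₂ := hsurf U hUo subset_rfl X₂ (hX₂.mono fun q hq => (hU q hq).1) q hqU
    have hsym : inducedForm f β q (X₂ q) (X₁ q) = inducedForm f β q (X₁ q) (X₂ q) :=
      h.metric.symm _ _
    have hs := Real.sqrt_pos.2 (hΔ q hqU)
    rw [transversalMetric, hs₁, hs₁, hs₂, hs₂, hsurf V hV hVU Y hY q hq, hsym]
    have e : Real.sqrt (Δ q) * inducedForm f β q (X₁ q) (X₁ q) *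
          (Real.sqrt (Δ q) * inducedForm f β q (X₂ q) (X₂ q)) -
        Real.sqrt (Δ q) * inducedForm f β q (X₁ q) (X₂ q) *
          (Real.sqrt (Δ q) * inducedForm f β q (X₁ q) (X₂ q)) = Real.sqrt (Δ q) ^ 4 := by
      have h1 := Real.sq_sqrt (hΔ q hqU).le
      have h2 : Real.sqrt (Δ q) ^ 2 * Δ q = Real.sqrt (Δ q) ^ 4 := by
        rw [← h1, Real.sqrt_sq hs.le]
        ring
      rw [← h2]
      ring
    have e2 : (Real.sqrt (Δ q) ^ 4) ^ (1 / 4 : ℝ) = Real.sqrt (Δ q) := by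
      rw [← Real.rpow_natCast, ← Real.rpow_mul hs.le]
      norm_num
    rw [e, e2]
    field_simp

end IsQuadricSurface

end Quadric

/-! ### Orthonormal frames and the difference of two induced connections -/

section Uniqueness

variable {M : Type*} [TopologicalSpace M] [ChartedSpace (EuclideanSpace ℝ (Fin 2)) M]
  {f : M → R4} {β : R4 →L[ℝ] R4 →L[ℝ] ℝ} {Q : R4 → ℝ} {ρ : ℝ}

theorem IsOrthonormalFrame.linearIndependent {V : Set M}
    {X₁ X₂ : (q : M) → TangentSpace (𝓡 2) q}
    (hX : IsOrthonormalFrame f (inducedForm f β) V X₁ X₂) {q : M} (hq : q ∈ V) :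
    LinearIndependent ℝ ![X₁ q, X₂ q] := by
  obtain ⟨h11, h12, h21, h22⟩ := hX.2.2 q hq
  rw [LinearIndependent.pair_iff]
  intro s t hst
  have h1 : inducedForm f β q (s • X₁ q + t • X₂ q) (X₁ q) = s := by
    simp only [inducedForm, map_add, map_smul, add_apply, smul_apply, smul_eq_mul] at *
    rw [h11, h21]
    ring
  have h2 : inducedForm f β q (s • X₁ q + t • X₂ q) (X₂ q) = t := by
    simp only [inducedForm, map_add, map_smul, add_apply, smul_apply, smul_eq_mul] at *
    rw [h12, h22]
    ring
  rw [hst] at h1 h2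
  simp only [inducedForm, map_zero, zero_apply] at h1 h2
  exact ⟨h1.symm, h2.symm⟩

/-- The area form dual to an orthonormal frame. -/
def frameArea (f : M → R4) (β : R4 →L[ℝ] R4 →L[ℝ] ℝ)
    (X₁ X₂ : (q : M) → TangentSpace (𝓡 2) q) (q : M) :
    TangentSpace (𝓡 2) q [⋀^Fin 2]→ₗ[ℝ] ℝ :=
  (Matrix.detRowAlternating (R := ℝ) (n := Fin 2)).compLinearMap
    (LinearMap.pi ![((β (dmap f q (X₁ q))).comp (dmap f q)).toLinearMap,
      ((β (dmap f q (X₂ q))).comp (dmap f q)).toLinearMap])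

theorem frameArea_apply (X₁ X₂ : (q : M) → TangentSpace (𝓡 2) q) (q : M)
    (u v : TangentSpace (𝓡 2) q) : frameArea f β X₁ X₂ q ![u, v] =
      inducedForm f β q (X₁ q) u * inducedForm f β q (X₂ q) v -
        inducedForm f β q (X₂ q) u * inducedForm f β q (X₁ q) v := by
  rw [frameArea, AlternatingMap.compLinearMap_apply]
  exact Matrix.det_fin_two _

theorem IsOrthonormalFrame.isAreaForm {V : Set M} (hV : IsOpen V)
    {X₁ X₂ : (q : M) → TangentSpace (𝓡 2) q}
    (hX : IsOrthonormalFrame f (inducedForm f β) V X₁ X₂) :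
    IsAreaForm f (inducedForm f β) V (frameArea f β X₁ X₂) := by
  constructor
  · intro q hq u v
    have h := hX.2.2 q hq
    obtain ⟨a, b, rfl⟩ := exists_smul_add_smul (hX.linearIndependent hq) u
    obtain ⟨c, d, rfl⟩ := exists_smul_add_smul (hX.linearIndependent hq) v
    rw [frameArea_apply]
    simp only [inducedForm, map_add, map_smul, add_apply, smul_apply, smul_eq_mul] at h ⊢
    obtain ⟨h11, h12, h21, h22⟩ := h
    rw [h11, h12, h21, h22]
    rw [← Real.sqrt_sq_eq_abs]
    refine congrArg Real.sqrt ((abs_of_nonneg (sq_nonneg _)).symm.trans (congrArg abs ?_))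
    ring
  · intro Y Z hY hZ
    simp only [frameArea_apply]
    intro q hq
    exact (((contMDiffAt_inducedForm hV hq hX.1 hY).mul
      (contMDiffAt_inducedForm hV hq hX.2.1 hZ)).sub
        ((contMDiffAt_inducedForm hV hq hX.2.1 hY).mul
          (contMDiffAt_inducedForm hV hq hX.1 hZ))).contMDiffWithinAt

variable [IsManifold (𝓡 2) ∞ M]

theorem InducesMetric.exists_orthonormalFrame (hβ : InducesMetric f β)
    (hf : IsSmoothImmersion f) {U : Set M} (hU : IsOpen U) {p : M} (hp : p ∈ U) :
    ∃ (V : Set M) (X₁ X₂ : (q : M) → TangentSpace (𝓡 2) q), IsOpen V ∧ p ∈ V ∧ V ⊆ U ∧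
      IsOrthonormalFrame f (inducedForm f β) V X₁ X₂ := by
  obtain ⟨V, Y₁, Y₂, hV, hpV, hY₁, hY₂, hY, -⟩ := exists_tangentFrame hf p
  let g₁₁ : M → ℝ := fun q => inducedForm f β q (Y₁ q) (Y₁ q)
  let g₁₂ : M → ℝ := fun q => inducedForm f β q (Y₁ q) (Y₂ q)
  let g₂₂ : M → ℝ := fun q => inducedForm f β q (Y₂ q) (Y₂ q)
  have h1 : ∀ q ∈ V, 0 < g₁₁ q := fun q hq => hβ.pos q _ ((hY q hq).ne_zero 0)
  have h2 : ∀ q ∈ V, 0 < g₁₁ q * (g₁₁ q * g₂₂ q - g₁₂ q * g₁₂ q) := by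
    intro q hq
    have := hβ.gram_pos (hY q hq)
    rw [sq] at this
    exact mul_pos (h1 q hq) this
  have hs : ∀ (φ : M → ℝ) (q : M), ContMDiffAt (𝓡 2) 𝓘(ℝ, ℝ) ∞ φ q → 0 < φ q →
      ContMDiffAt (𝓡 2) 𝓘(ℝ, ℝ) ∞ (fun q => (Real.sqrt (φ q))⁻¹) q := by
    intro φ q hφ hpos
    exact ContMDiffAt.inv₀ (ContMDiffAt.comp q (g := Real.sqrt)
      (Real.contDiffAt_sqrt hpos.ne').contMDiffAt hφ) (Real.sqrt_pos.2 hpos).ne'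
  have c₁₁ : ∀ q ∈ V, ContMDiffAt (𝓡 2) 𝓘(ℝ, ℝ) ∞ g₁₁ q := fun q hq =>
    contMDiffAt_inducedForm hV hq hY₁ hY₁
  have c₁₂ : ∀ q ∈ V, ContMDiffAt (𝓡 2) 𝓘(ℝ, ℝ) ∞ g₁₂ q := fun q hq =>
    contMDiffAt_inducedForm hV hq hY₁ hY₂
  have c₂₂ : ∀ q ∈ V, ContMDiffAt (𝓡 2) 𝓘(ℝ, ℝ) ∞ g₂₂ q := fun q hq =>
    contMDiffAt_inducedForm hV hq hY₂ hY₂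
  have hX₁ : IsTangentField f V fun q => (Real.sqrt (g₁₁ q))⁻¹ • Y₁ q := by
    refine (isTangentField_iff hV).2 fun q hq => ?_
    simp only [map_smul]
    exact (hs g₁₁ q (c₁₁ q hq) (h1 q hq)).smul (hY₁.contMDiffAt hV hq)
  -- Gram–Schmidt without a first division: `g₁₁ Y₂ - g₁₂ Y₁` is orthogonal to `Y₁` and has square
  -- `g₁₁ (g₁₁ g₂₂ - g₁₂²)`.
  have hX₂ : IsTangentField f V fun q =>
      (Real.sqrt (g₁₁ q * (g₁₁ q * g₂₂ q - g₁₂ q * g₁₂ q)))⁻¹ •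
        (g₁₁ q • Y₂ q - g₁₂ q • Y₁ q) := by
    refine (isTangentField_iff hV).2 fun q hq => ?_
    simp only [map_smul, map_sub]
    exact (hs (fun q => g₁₁ q * (g₁₁ q * g₂₂ q - g₁₂ q * g₁₂ q)) q
      ((c₁₁ q hq).mul (((c₁₁ q hq).mul (c₂₂ q hq)).sub ((c₁₂ q hq).mul (c₁₂ q hq))))
      (h2 q hq)).smul (((c₁₁ q hq).smul (hY₂.contMDiffAt hV hq)).sub
        ((c₁₂ q hq).smul (hY₁.contMDiffAt hV hq)))
  refine ⟨V ∩ U, _, _, hV.inter hU, ⟨hpV, hp⟩, Set.inter_subset_right,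
    hX₁.mono Set.inter_subset_left, hX₂.mono Set.inter_subset_left, fun q hq => ?_⟩
  have p1 := Real.sqrt_pos.2 (h1 q hq.1)
  have p2 := Real.sqrt_pos.2 (h2 q hq.1)
  have e1 := Real.sq_sqrt (h1 q hq.1).le
  have e2 := Real.sq_sqrt (h2 q hq.1).le
  have q1 : β (dmap f q (Y₁ q)) (dmap f q (Y₁ q)) = g₁₁ q := rfl
  have q2 : β (dmap f q (Y₁ q)) (dmap f q (Y₂ q)) = g₁₂ q := rfl
  have q3 : β (dmap f q (Y₂ q)) (dmap f q (Y₁ q)) = g₁₂ q := hβ.symm _ _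
  have q4 : β (dmap f q (Y₂ q)) (dmap f q (Y₂ q)) = g₂₂ q := rfl
  generalize Real.sqrt (g₁₁ q * (g₁₁ q * g₂₂ q - g₁₂ q * g₁₂ q)) = r2 at *
  generalize Real.sqrt (g₁₁ q) = r1 at *
  simp only [inducedForm, map_smul, map_sub, sub_apply, smul_apply, smul_eq_mul, q1, q2, q3, q4]
  refine ⟨?_, ?_, ?_, ?_⟩
  · field_simp
    exact e1.symm
  · ring
  · ring
  · field_simp
    rw [e2]
    ring

/-- The covariant derivative of the metric, in terms of the difference of two connections. -/
theorem InducesMetric.nablaForm_eq (hβ : InducesMetric f β) (hf : IsSmoothImmersion f)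
    (τ : M → Submodule ℝ R4) {V : Set M} (hV : IsOpen V) {p : M} (hp : p ∈ V)
    {Y Z : (q : M) → TangentSpace (𝓡 2) q}
    (hY : IsTangentField f V Y) (hZ : IsTangentField f V Z) (x : TangentSpace (𝓡 2) p) :
    nablaForm f τ (inducedForm f β) p x Y Z =
      -(inducedForm f β p (nabla f τ p x Y - nabla f (orthoPlane f β) p x Y) (Z p) +
        inducedForm f β p (nabla f τ p x Z - nabla f (orthoPlane f β) p x Z) (Y p)) := by
  rw [nablaForm, hβ.dfun_inducedForm hf hV hp hY hZ]
  simp only [inducedForm, map_sub, sub_apply, hβ.symm (dmap f p (Y p))]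
  ring

/-- The difference is the bracket of the fields. A conormal not vanishing on it would contradict the
symmetry of its second fundamental form. -/
theorem flatD_sub_flatD_mem (hf : IsSmoothImmersion f) {V : Set M} (hV : IsOpen V) {p : M}
    (hp : p ∈ V) {Y Z : (q : M) → TangentSpace (𝓡 2) q}
    (hY : IsTangentField f V Y) (hZ : IsTangentField f V Z) :
    flatD f p (Y p) Z - flatD f p (Z p) Y ∈ tangentPlane f p := by
  by_contra hne
  obtain ⟨lam, hlam0, hlam⟩ := Submodule.exists_le_ker_of_notMem hne
  obtain ⟨Ξ, hΞ, hs⟩ := exists_conormal_form hf (lam := lam) fun v hv => hlam hv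
  apply hlam0
  rw [map_sub, hΞ V hV hp Z hZ, hΞ V hV hp Y hY, hs, sub_self]

/-- The connections of two transversal bundles have the same torsion. -/
theorem nabla_sub_nabla_symm (hf : IsSmoothImmersion f) {σ τ : M → Submodule ℝ R4} {V : Set M}
    (hV : IsOpen V) {p : M} (hp : p ∈ V) (hσ : IsCompl (tangentPlane f p) (σ p))
    (hτ : IsCompl (tangentPlane f p) (τ p)) {Y Z : (q : M) → TangentSpace (𝓡 2) q}
    (hY : IsTangentField f V Y) (hZ : IsTangentField f V Z) :
    nabla f τ p (Y p) Z - nabla f σ p (Y p) Z = nabla f τ p (Z p) Y - nabla f σ p (Z p) Y := by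
  have key : ∀ ρ : M → Submodule ℝ R4, IsCompl (tangentPlane f p) (ρ p) →
      dmap f p (nabla f ρ p (Y p) Z - nabla f ρ p (Z p) Y) =
        flatD f p (Y p) Z - flatD f p (Z p) Y := by
    intro ρ hρ
    have h1 := (ρ p).sub_mem (nabla_spec hρ (Y p) Z) (nabla_spec hρ (Z p) Y)
    have h2 := (tangentPlane f p).sub_mem (flatD_sub_flatD_mem hf hV hp hY hZ)
      (dmap_mem_tangentPlane f p (nabla f ρ p (Y p) Z - nabla f ρ p (Z p) Y))
    have h3 := Submodule.disjoint_def.1 hρ.disjoint _ h2 (by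
      convert h1 using 1
      rw [map_sub]
      abel)
    exact (sub_eq_zero.1 h3).symm
  have h := hf.2 p ((key τ hτ).trans (key σ hσ).symm)
  rw [sub_eq_iff_eq_add] at h ⊢
  rw [h]
  abel

end Uniqueness

/-! ### Coincidence of the equiaffine planes away from inflections -/

section Coincidence

variable {M : Type*} [TopologicalSpace M] [ChartedSpace (EuclideanSpace ℝ (Fin 2)) M]
  {f : M → R4} {β : R4 →L[ℝ] R4 →L[ℝ] ℝ} {Q : R4 → ℝ} {ρ : ℝ}

theorem InducesMetric.eq_zero_of_frame (hβ : InducesMetric f β) {q : M}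
    {u v t : TangentSpace (𝓡 2) q} (huv : LinearIndependent ℝ ![u, v])
    (hu : inducedForm f β q t u = 0) (hv : inducedForm f β q t v = 0) : t = 0 := by
  obtain ⟨a, b, hab⟩ := exists_smul_add_smul huv t
  by_contra hne
  refine (hβ.pos q t hne).ne' ?_
  rw [inducedForm] at hu hv
  calc β (dmap f q t) (dmap f q t) = β (dmap f q t) (dmap f q (a • u + b • v)) := by rw [← hab]
    _ = 0 := by simp [hu, hv]

/-- Vectors of the tangent hyperplane are dependent modulo the tangent plane of the surface. -/
theorem exists_combination_mem_tangentPlane {L : R4 →L[ℝ] ℝ} (hL : L ≠ 0) {p : M}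
    (hT : ∀ u, L (dmap f p u) = 0) {X₁ X₂ : TangentSpace (𝓡 2) p}
    (hf : Function.Injective (dmap f p)) (hX : LinearIndependent ℝ ![X₁, X₂]) {v w : R4}
    (hv : L v = 0) (hw : L w = 0) :
    ∃ a b : ℝ, (a ≠ 0 ∨ b ≠ 0) ∧ a • v + b • w ∈ tangentPlane f p := by
  obtain ⟨n, hn⟩ : ∃ n, L n ≠ 0 := by
    by_contra! h
    exact hL (ContinuousLinearMap.ext h)
  -- `X₁, X₂, v, w` all lie in the 3-dimensional kernel of `L`, so their determinant vanishes. The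
  -- independence of `X₁, X₂` forces the relation to involve `v` or `w`.
  have h0 := det4_mul_apply L (hT X₁) (hT X₂) hw v n
  rw [hv, mul_zero] at h0
  obtain ⟨c, hc, hc0⟩ := Matrix.exists_vecMul_eq_zero_iff.2
    ((mul_eq_zero.1 h0).resolve_right hn)
  have e : c 0 • dmap f p X₁ + c 1 • dmap f p X₂ + (c 2 • v + c 3 • w) = 0 := by
    rw [← hc0]
    ext i
    simp [Matrix.vecMul, dotProduct, Fin.sum_univ_four]
    ring
  rw [← map_smul, ← map_smul, ← map_add] at e
  refine ⟨c 2, c 3, ?_, ?_⟩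
  · by_contra! h
    rw [h.1, h.2, zero_smul, zero_smul, add_zero, add_zero] at e
    have e5 := LinearIndependent.pair_iff.1 hX _ _ (hf (e.trans (map_zero (dmap f p)).symm))
    apply hc
    ext i
    fin_cases i
    · exact e5.1
    · exact e5.2
    · exact h.1
    · exact h.2
  · rw [eq_neg_of_add_eq_zero_right e]
    exact Submodule.neg_mem _ (dmap_mem_tangentPlane f p _)

/-- Surfaces in a locally strictly convex hyperquadric, and their extended Blaschke metrics. -/
theorem exists_isQuadricSurface {f : M → R4} {Q : R4 → ℝ} (hQ : IsConvexHyperquadric Q)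
    (hf : IsSmoothImmersion f) (hfQ : ∀ p, Q (f p) = 0) (hM : Nonempty M) :
    ∃ β ρ, IsQuadricSurface f Q β ρ ∧ blaschkeOn Q f = inducedForm f β ∧
      ∀ ζ, IsAffineNormal Q ζ → ∀ κ p v, ∀ w ∈ tangentPlane f p,
        extendedBlaschke Q ζ κ (f p) v w = β v w := by
  obtain ⟨p₀⟩ := hM
  obtain ⟨B, l, hB⟩ := hQ.exists_isQuadricWith
  obtain ⟨-, β, ρ, hs, hρ, hd, hbl, hpos, hn⟩ := hQ.exists_flat_form ⟨f p₀, hfQ p₀⟩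
  have htan := fderiv_dmap_eq_zero hf hB.contDiff hfQ
  refine ⟨β, ρ, ⟨hf, hB.contDiff, hfQ, fun p => (hQ.2 _ (hfQ p)).1, hd, hρ, hs, ?_⟩, ?_, ?_⟩
  · intro q u hu
    exact hpos _ (hfQ q) _ (htan q u) fun h0 => hu (hf.2 q (h0.trans (map_zero _).symm))
  · funext q u v
    exact hbl _ (hfQ q) _ (htan q u) _ (htan q v)
  · rintro ζ hζ κ p v _ ⟨u, rfl⟩
    have hw : fderiv ℝ Q (f p) (dmap f p u) = 0 := htan p u
    have hζ0 : fderiv ℝ Q (f p) (ζ (f p)) ≠ 0 := (hζ _ (hfQ p)).2.1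
    have hw0 : normalCoeff Q ζ (f p) (dmap f p u) = 0 := by rw [normalCoeff, hw, zero_div]
    have hv : v - normalCoeff Q ζ (f p) v • ζ (f p) ∈ hyperTangent Q (f p) := by
      change fderiv ℝ Q (f p) _ = 0
      rw [map_sub, map_smul, normalCoeff, smul_eq_mul, div_mul_cancel₀ _ hζ0, sub_self]
    change extendedBlaschke Q ζ κ (f p) v (dmap f p u) = β v (dmap f p u)
    -- `w` has no component along `ζ`, so the term with `κ` disappears; orthogonality of `ζ` puts
    -- the component of `v` along `ζ` back for free.
    rw [extendedBlaschke, hw0, zero_smul, sub_zero, hbl _ (hfQ p) _ hv _ hw]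
    simp [hn ζ hζ _ (hfQ p) _ hw]

variable [IsManifold (𝓡 2) ∞ M]

/-- If two complements of the tangent plane split all the derivatives of a tangent frame in the same
way, they coincide away from inflections. -/
theorem eq_of_not_isInflection (hf : IsSmoothImmersion f) {p : M} {σ τ : Submodule ℝ R4}
    (hσ : IsCompl (tangentPlane f p) σ) (hτ : IsCompl (tangentPlane f p) τ)
    {V : Set M} (hV : IsOpen V) (hp : p ∈ V) {X : Fin 2 → (q : M) → TangentSpace (𝓡 2) q}
    (hX : ∀ i, IsTangentField f V (X i)) (hli : LinearIndependent ℝ ![X 0 p, X 1 p])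
    (hsplit : ∀ i j, ∃ t, flatD f p (X i p) (X j) - dmap f p t ∈ σ ∧
      flatD f p (X i p) (X j) - dmap f p t ∈ τ)
    (hinf : ¬ IsInflection f p) : τ = σ := by
  -- Otherwise a nonzero functional kills the tangent plane and `σ ⊓ τ`, hence every `D_{X_i} X_j`,
  -- and by tensoriality `p` is an inflection.
  have htop : tangentPlane f p ⊔ (σ ⊓ τ) = ⊤ := by
    by_contra hne
    obtain ⟨lam, hlam0, hlam⟩ := Submodule.exists_le_ker_of_lt_top _ (lt_top_iff_ne_top.2 hne)
    have hT : ∀ v ∈ tangentPlane f p, lam v = 0 := fun v hv => hlam (Submodule.mem_sup_left hv)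
    obtain ⟨Ξ, hΞ, -⟩ := exists_conormal_form hf hT
    have h0 : ∀ i j, Ξ (X i p) (dmap f p (X j p)) = 0 := by
      intro i j
      rw [← hΞ V hV hp (X j) (hX j)]
      obtain ⟨t, hts, htt⟩ := hsplit i j
      have h1 : lam (flatD f p (X i p) (X j) - dmap f p t) = 0 :=
        hlam (Submodule.mem_sup_right ⟨hts, htt⟩)
      rwa [map_sub, hT _ (dmap_mem_tangentPlane f p t), sub_zero] at h1
    refine hinf ⟨lam, hlam0, hT, fun V' hV' hp' Y hY x => ?_⟩
    rw [hΞ V' hV' hp' Y hY]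
    obtain ⟨a, b, hx⟩ := exists_smul_add_smul hli x
    obtain ⟨c, d, hy⟩ := exists_smul_add_smul hli (Y p)
    rw [hx, hy]
    simp [h0]
  -- A complement of the tangent plane that contains another supplement of it must equal that
  -- supplement.
  have hle : ∀ {ρ : Submodule ℝ R4}, IsCompl (tangentPlane f p) ρ → σ ⊓ τ ≤ ρ → ρ ≤ σ ⊓ τ := by
    intro ρ hρ hle v hv
    have h1 : v ∈ tangentPlane f p ⊔ (σ ⊓ τ) := by rw [htop]; trivial
    obtain ⟨t, ht, s, hs, rfl⟩ := Submodule.mem_sup.1 h1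
    have h2 : t ∈ ρ := by simpa using ρ.sub_mem hv (hle hs)
    rw [Submodule.disjoint_def.1 hρ.disjoint t ht h2, zero_add]
    exact hs
  exact le_antisymm ((hle hτ inf_le_right).trans inf_le_left)
    ((hle hσ inf_le_left).trans inf_le_right)

namespace IsQuadricSurface

theorem eq_orthoPlane (h : IsQuadricSurface f Q β ρ) {U : Set M} {τ : M → Submodule ℝ R4}
    (hU : IsOpen U) (hτ : IsAntisymmetricEquiaffine f (inducedForm f β) U τ ∨
      IsSymmetricEquiaffine f (inducedForm f β) U τ) {p : M} (hp : p ∈ U)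
    (hinf : ¬ IsInflection f p) : τ p = orthoPlane f β p := by
  have hf := h.immersion
  have hβ := h.metric
  have hτc : IsCompl (tangentPlane f p) (τ p) :=
    hτ.elim (fun h => (h.1 p hp).1) fun h => (h.1 p hp).1
  have hτe : IsEquiaffine f (inducedForm f β) U τ := hτ.elim (fun h => h.2.1) fun h => h.2.1
  have hσc := hβ.isCompl_orthoPlane hf p
  obtain ⟨V, X₁, X₂, hV, hpV, hVU, hX⟩ := hβ.exists_orthonormalFrame hf hU hp
  have hli := hX.linearIndependent hpV
  have hα := hX.isAreaForm hV
  obtain ⟨h11, h12, h21, h22⟩ := hX.2.2 p hpV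
  have hX₁ := hX.1
  have hX₂ := hX.2.1
  -- Equiaffinity of both bundles, tested on the area form of the frame, says that the difference
  -- tensor has trace zero.
  have htr : ∀ x : TangentSpace (𝓡 2) p,
      inducedForm f β p (nabla f τ p x X₁ - nabla f (orthoPlane f β) p x X₁) (X₁ p) +
        inducedForm f β p (nabla f τ p x X₂ - nabla f (orthoPlane f β) p x X₂) (X₂ p) = 0 := by
    intro x
    have e1 := hτe V hV hVU _ hα X₁ X₂ hX₁ hX₂ p hpV x
    have e2 := hβ.isEquiaffine hf V hV (Set.subset_univ _) _ hα X₁ X₂ hX₁ hX₂ p hpV x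
    simp only [nablaForm, frameArea_apply, h11, h12, h21, h22] at e1 e2
    simp only [inducedForm, map_sub, sub_apply] at e1 e2 ⊢
    simp only [hβ.symm (dmap f p (nabla _ _ _ _ _))]
    linear_combination e2 - e1
  have hsymm : nabla f τ p (X₁ p) X₂ - nabla f (orthoPlane f β) p (X₁ p) X₂ =
      nabla f τ p (X₂ p) X₁ - nabla f (orthoPlane f β) p (X₂ p) X₁ :=
    nabla_sub_nabla_symm hf hV hpV hσc hτc hX₁ hX₂
  have hQX : ∀ u, fderiv ℝ Q (f p) (dmap f p u) = 0 :=
    fderiv_dmap_eq_zero hf h.contDiff h.mem p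
  -- In an orthonormal frame `dQ` takes the value `-ρ` on both `D₁X₁` and `D₂X₂`, and `0` on `D₁X₂`.
  obtain ⟨a, b, hab, hmem⟩ := exists_combination_mem_tangentPlane (h.regular p) hQX (hf.2 p) hli
    (v := flatD f p (X₁ p) X₁ - flatD f p (X₂ p) X₂) (w := flatD f p (X₁ p) X₂)
    (by rw [map_sub, h.fderiv_flatD hV hpV hX₁, h.fderiv_flatD hV hpV hX₂, h11, h22, sub_self])
    (by rw [h.fderiv_flatD hV hpV hX₂, h12, mul_zero])
  have hcomb : a • ((nabla f τ p (X₁ p) X₁ - nabla f (orthoPlane f β) p (X₁ p) X₁) -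
        (nabla f τ p (X₂ p) X₂ - nabla f (orthoPlane f β) p (X₂ p) X₂)) +
      b • (nabla f τ p (X₁ p) X₂ - nabla f (orthoPlane f β) p (X₁ p) X₂) = 0 := by
    -- The combination is tangent, so its tangential part is itself, whatever the transversal plane.
    have key : ∀ ν : M → Submodule ℝ R4, IsCompl (tangentPlane f p) (ν p) →
        dmap f p (a • (nabla f ν p (X₁ p) X₁ - nabla f ν p (X₂ p) X₂) +
          b • nabla f ν p (X₁ p) X₂) =
        a • (flatD f p (X₁ p) X₁ - flatD f p (X₂ p) X₂) + b • flatD f p (X₁ p) X₂ := by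
      intro ν hν
      have h1 := (ν p).add_mem ((ν p).smul_mem a ((ν p).sub_mem (nabla_spec hν (X₁ p) X₁)
        (nabla_spec hν (X₂ p) X₂))) ((ν p).smul_mem b (nabla_spec hν (X₁ p) X₂))
      have h2 := (tangentPlane f p).sub_mem hmem (dmap_mem_tangentPlane f p
        (a • (nabla f ν p (X₁ p) X₁ - nabla f ν p (X₂ p) X₂) + b • nabla f ν p (X₁ p) X₂))
      have h3 := Submodule.disjoint_def.1 hν.disjoint _ h2 (by
        convert h1 using 1
        simp only [map_add, map_smul, map_sub]
        module)
      exact (sub_eq_zero.1 h3).symm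
    have h4 := hf.2 p ((key τ hτc).trans (key _ hσc).symm)
    rw [← sub_eq_zero] at h4
    rw [← h4]
    module
  have hsk : ∀ x Y Z, IsTangentField f V Y → IsTangentField f V Z → _ :=
    fun x Y Z hY hZ => hβ.nablaForm_eq hf τ hV hpV (Y := Y) (Z := Z) hY hZ x
  -- The sign `s` treats the antisymmetric case (`1`) and the symmetric case (`-1`) together.
  have hcond : (∃ s : ℝ, (s = 1 ∨ s = -1) ∧
      nablaForm f τ (inducedForm f β) p (X₂ p) X₁ X₁ +
        s * nablaForm f τ (inducedForm f β) p (X₁ p) X₂ X₁ = 0 ∧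
      nablaForm f τ (inducedForm f β) p (X₁ p) X₂ X₂ +
        s * nablaForm f τ (inducedForm f β) p (X₂ p) X₁ X₂ = 0) := by
    rcases hτ with hτ | hτ
    · obtain ⟨e1, e2⟩ := hτ.2.2 V hV hVU X₁ X₂ hX p hpV
      exact ⟨1, Or.inl rfl, by rw [one_mul, e1], by rw [one_mul, e2]⟩
    · obtain ⟨e1, e2⟩ := hτ.2.2 V hV hVU X₁ X₂ hX p hpV
      exact ⟨-1, Or.inr rfl, by linarith, by linarith⟩
  obtain ⟨s, hs, hc1, hc2⟩ := hcond
  rw [hsk _ _ _ hX₁ hX₁, hsk _ _ _ hX₂ hX₁] at hc1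
  rw [hsk _ _ _ hX₂ hX₂, hsk _ _ _ hX₁ hX₂] at hc2
  have htr1 := htr (X₁ p)
  have htr2 := htr (X₂ p)
  rw [← hsymm] at hc1 hc2 htr2
  have hk1 := congrArg (fun t => inducedForm f β p t (X₁ p)) hcomb
  have hk2 := congrArg (fun t => inducedForm f β p t (X₂ p)) hcomb
  have hlin : ∀ (r₁ r₂ : ℝ) (c₁ c₂ c₃ u : TangentSpace (𝓡 2) p),
      inducedForm f β p (r₁ • (c₁ - c₂) + r₂ • c₃) u =
        r₁ * (inducedForm f β p c₁ u - inducedForm f β p c₂ u) +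
          r₂ * inducedForm f β p c₃ u := by
    intro r₁ r₂ c₁ c₂ c₃ u
    simp [inducedForm]
  have h0u : ∀ u, inducedForm f β p 0 u = 0 := fun u => by simp [inducedForm]
  simp only [hlin, h0u] at hk1 hk2
  have hz11 := hβ.eq_zero_of_frame (t :=
    nabla f τ p (X₁ p) X₁ - nabla f (orthoPlane f β) p (X₁ p) X₁) hli
  have hz12 := hβ.eq_zero_of_frame (t :=
    nabla f τ p (X₁ p) X₂ - nabla f (orthoPlane f β) p (X₁ p) X₂) hli
  have hz22 := hβ.eq_zero_of_frame (t :=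
    nabla f τ p (X₂ p) X₂ - nabla f (orthoPlane f β) p (X₂ p) X₂) hli
  have hsplit : nabla f τ p (X₁ p) X₁ - nabla f (orthoPlane f β) p (X₁ p) X₁ = 0 ∧
      nabla f τ p (X₁ p) X₂ - nabla f (orthoPlane f β) p (X₁ p) X₂ = 0 ∧
      nabla f τ p (X₂ p) X₂ - nabla f (orthoPlane f β) p (X₂ p) X₂ = 0 := by
    generalize nabla f τ p (X₁ p) X₁ - nabla f (orthoPlane f β) p (X₁ p) X₁ = c11 at *
    generalize nabla f τ p (X₁ p) X₂ - nabla f (orthoPlane f β) p (X₁ p) X₂ = c12 at *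
    generalize nabla f τ p (X₂ p) X₂ - nabla f (orthoPlane f β) p (X₂ p) X₂ = c22 at *
    generalize inducedForm f β p c11 (X₁ p) = c111 at *
    generalize inducedForm f β p c11 (X₂ p) = c112 at *
    generalize inducedForm f β p c12 (X₁ p) = c121 at *
    generalize inducedForm f β p c12 (X₂ p) = c122 at *
    generalize inducedForm f β p c22 (X₁ p) = c221 at *
    generalize inducedForm f β p c22 (X₂ p) = c222 at *
    have hpos : 0 < 4 * a ^ 2 + b ^ 2 := by
      rcases hab with h | h <;> positivity
    -- Write `c_{ijk} = g(C(X_i, X_j), X_k)`. Trace gives `c111 = -c122` and `c222 = -c121`. The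
    -- other conditions give `c112 = -3 c121`, `c221 = -3 c122` for `s = 1`, and `c112 = c121`,
    -- `c221 = c122` for `s = -1`. What remains is a system in `c121, c122` of determinant `4a² +
    -- b²`; the sum of squares of its equations is the claim.
    have hsq : (4 * a ^ 2 + b ^ 2) * (c121 ^ 2 + c122 ^ 2) = 0 := by
      rcases hs with rfl | rfl
      · have k1 : 2 * a * c122 + b * c121 = 0 := by
          linear_combination hk1 - a * (htr1 + hc2)
        have k2 : -2 * a * c121 + b * c122 = 0 := by
          linear_combination hk2 + a * (hc1 + htr2)
        linear_combination (2 * a * c122 + b * c121) * k1 + (-2 * a * c121 + b * c122) * k2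
      · have k1 : -2 * a * c122 + b * c121 = 0 := by
          linear_combination hk1 - a * (htr1 - hc2)
        have k2 : 2 * a * c121 + b * c122 = 0 := by
          linear_combination hk2 - a * (hc1 - htr2)
        linear_combination (-2 * a * c122 + b * c121) * k1 + (2 * a * c121 + b * c122) * k2
    have hsq' := (mul_eq_zero.1 hsq).resolve_left hpos.ne'
    have z1 : c121 = 0 := by nlinarith [sq_nonneg c121, sq_nonneg c122]
    have z2 : c122 = 0 := by nlinarith [sq_nonneg c121, sq_nonneg c122]
    subst z1 z2
    refine ⟨hz11 ?_ ?_, hz12 rfl rfl, hz22 ?_ ?_⟩ <;>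
      rcases hs with rfl | rfl <;> linarith
  obtain ⟨z11, z12, z22⟩ := hsplit
  have z21 := hsymm.symm.trans z12
  refine eq_of_not_isInflection hf hσc hτc hV hpV (X := ![X₁, X₂]) ?_ hli ?_ hinf
  · intro i
    fin_cases i
    · exact hX₁
    · exact hX₂
  · have key : ∀ (x : TangentSpace (𝓡 2) p) (Y : (q : M) → TangentSpace (𝓡 2) q),
        nabla f τ p x Y - nabla f (orthoPlane f β) p x Y = 0 →
        ∃ t, flatD f p x Y - dmap f p t ∈ orthoPlane f β p ∧
          flatD f p x Y - dmap f p t ∈ τ p := by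
      intro x Y hz
      refine ⟨nabla f τ p x Y, ?_, nabla_spec hτc x Y⟩
      rw [sub_eq_zero.1 hz]
      exact nabla_spec hσc x Y
    intro i j
    fin_cases i <;> fin_cases j
    · exact key _ _ z11
    · exact key _ _ z12
    · exact key _ _ z21
    · exact key _ _ z22

end IsQuadricSurface

end Coincidence

end AffineSurface

end

open AffineSurface in
theorem mainTheorem4 {M : Type*} [TopologicalSpace M]
    [ChartedSpace (EuclideanSpace ℝ (Fin 2)) M] [IsManifold (𝓡 2) ∞ M]
    (Q : R4 → ℝ) (hQ : IsConvexHyperquadric Q)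
    (f : M → R4) (hf : IsSmoothImmersion f) (hfQ : ∀ p, Q (f p) = 0) :
    (∃ ζ, IsAffineNormal Q ζ) ∧
    (∀ p : M, ∃ U X₁ X₂ ξ, IsOpen U ∧ p ∈ U ∧ IsMetricField f U X₁ X₂ ξ ∧
      ∀ V, IsOpen V → V ⊆ U → ∀ Y, IsTangentField f V Y → ∀ q ∈ V,
        ∀ z : TangentSpace (𝓡 2) q,
          transversalMetric f X₁ X₂ ξ q Y z = blaschkeOn Q f q (Y q) z) ∧
    ∀ ζ, IsAffineNormal Q ζ → ∀ κ : R4 → ℝ,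
      ∃ σ : M → Submodule ℝ R4,
        (∀ p v, v ∈ σ p ↔
          ∀ w ∈ tangentPlane f p, extendedBlaschke Q ζ κ (f p) v w = 0) ∧
        IsAntisymmetricEquiaffine f (blaschkeOn Q f) Set.univ σ ∧
        IsSymmetricEquiaffine f (blaschkeOn Q f) Set.univ σ ∧
        ∀ (U : Set M) (τ : M → Submodule ℝ R4), IsOpen U →
          (IsAntisymmetricEquiaffine f (blaschkeOn Q f) U τ ∨
            IsSymmetricEquiaffine f (blaschkeOn Q f) U τ) →
          ∀ p ∈ U, ¬ IsInflection f p → τ p = σ p := by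
  refine ⟨exists_isAffineNormal hQ, ?_, ?_⟩
  · intro p
    obtain ⟨β, ρ, h, hg, -⟩ := exists_isQuadricSurface hQ hf hfQ ⟨p⟩
    rw [hg]
    exact h.exists_metricField p
  · intro ζ hζ κ
    -- The constant form is obtained from a point of the quadric, which an empty surface does not
    -- supply; there any `σ` works.
    rcases isEmpty_or_nonempty M with hM | hM
    · refine ⟨fun _ => ⊥, fun p => isEmptyElim p, ?_, ?_, fun _ _ _ _ p => isEmptyElim p⟩
      · exact ⟨fun p => isEmptyElim p, fun _ _ _ _ _ _ _ _ _ p => isEmptyElim p,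
          fun _ _ _ _ _ _ p => isEmptyElim p⟩
      · exact ⟨fun p => isEmptyElim p, fun _ _ _ _ _ _ _ _ _ p => isEmptyElim p,
          fun _ _ _ _ _ _ p => isEmptyElim p⟩
    · obtain ⟨β, ρ, h, hg, hE⟩ := exists_isQuadricSurface hQ hf hfQ hM
      rw [hg]
      refine ⟨orthoPlane f β, fun p v => ?_, h.metric.isAntisymmetricEquiaffine hf,
        h.metric.isSymmetricEquiaffine hf, fun U τ hU hτ p hp hinf =>
          h.eq_orthoPlane hU hτ hp hinf⟩
      rw [mem_orthoPlane]
      exact forall₂_congr fun w hw => by rw [hE ζ hζ κ p v w hw]
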